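/- Fix, for every regular cardinal $\kappa$, a well-ordering $\lhd^*$ of $H(\kappa)$ (the set of all sets whose transitive closure has size less than $\kappa$). Write $N\prec H(\kappa)$ if $\langle N,\in,\lhd^*\rangle$ is an elementary substructure of $\langle H(\kappa),\in,\lhd^*\rangle$, put $\delta_N=N\cap\omega_1$, and let $\mathcal S$ be the collection of all countable $M\prec H(\omega_1)$. Let $\mathbb P$ be the set of all pairs $p=\langle\mathcal M_p,f_p\rangle$, where $\mathcal M_p=\langle M^p_i: i<n_p\rangle$ is a finite $\in$-increasing sequence of elements of $\mathcal S$ and $f_p$ is a function on $\{M^p_i:i<n_p\}$ such that $f_p(M^p_i)$ is a finite subset of $M^p_{i+1}$ for $i+1<n_p$, and $f_p(M^p_{n_p-1})$ is a finite subset of $H(\omega_1)$ if $n_p>0$. Order $\mathbb P$ by $q\le p$ iff $\mathcal M_p\subseteq\mathcal M_q$ (as sets of models) and $f_p(M)\subseteq f_q(M)$ for every $M\in\mathcal M_p$. Let $\dot C=\{(\check\delta_M,p): p\in\mathbb P,\ M\in\mathcal M_p\}$ be the canonical name for $C=\{\delta_M: M\in\mathcal M_p\text{ for some }p\in G\}$.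 For $\alpha<\omega_1$, an $\alpha$-tower in $H(\kappa)$, $\kappa$ regular, is a sequence $\langle N_\xi:\xi\le\alpha\rangle$ of countable elementary substructures of $H(\kappa)$ with $\alpha\in N_0$; $N_\zeta\in N_{\zeta+1}$ and $\langle N_\xi:\xi\le\zeta\rangle\in N_{\zeta+1}$ for all $\zeta<\alpha$; and $N_\delta=\bigcup_{\xi<\delta}N_\xi$ for all limit $\delta\le\alpha$. A condition $q$ is $(N,\mathbb P)$-generic if for every dense open $D\subseteq\mathbb P$ with $D\in N$, $D\cap N$ is predense below $q$. The forcing notion $\mathbb P$ is $\alpha$-proper if for every regular $\kappa$ and every $\alpha$-tower in $H(\kappa)$ with $\mathbb P\in N_0$, every $p\in\mathbb P\cap N_0$ has an extension $q\le p$ that is $(N_\xi,\mathbb P)$-generic for all $\xi\le\alpha$. Then $\mathbb P$ is not $\omega$-proper; indeed, for every regular $\kappa>(2^{|\mathrm{tr}(\mathbb P)|})^+$, where $\mathrm{tr}(\mathbb P)$ is the transitive closure of $\mathbb P$, there is an $\omega$-tower in $H(\kappa)$ with $\mathbb P\in N_0$ and a condition $p\in\mathbb P\cap N_0$ that has no extension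 which is $(N_i,\mathbb P)$-generic for all $i\le\omega$. Moreover, for every regular $\kappa$ and every $\omega$-tower $\langle N_i:i\le\omega\rangle$ in $H(\kappa)$ with $\mathbb P,\dot C\in N_0$: 1. no $q\in\mathbb P$ is $(N_i,\mathbb P)$-generic for all $i\le\omega$; 2. for every $q\in\mathbb P$ there are $m<\omega$ and $r\le q$ such that $r\Vdash\check\delta_{N_m}\notin\dot C$. -/

import Mathlib

universe u

namespace ClubForcing

open Cardinal Ordinal

/-! ### Transitive closures and the classes `H(κ)` -/

/-- The transitive closure of `x`: the least transitive set including `x`. The bounding set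
`V_ (rank x)` is itself transitive and includes `x`, see `mem_trCl`. -/
noncomputable def trCl (x : ZFSet.{u}) : ZFSet.{u} :=
  ZFSet.sep (fun y => ∀ t : ZFSet.{u}, t.IsTransitive → x ⊆ t → y ∈ t) (ZFSet.vonNeumann x.rank)

theorem mem_trCl {x y : ZFSet.{u}} :
    y ∈ trCl x ↔ ∀ t : ZFSet.{u}, t.IsTransitive → x ⊆ t → y ∈ t := by
  rw [trCl, ZFSet.mem_sep]
  exact ⟨fun h => h.2, fun h => ⟨h _ (ZFSet.isTransitive_vonNeumann _)
    (ZFSet.subset_vonNeumann_self x), h⟩⟩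

theorem subset_trCl (x : ZFSet.{u}) : x ⊆ trCl x := fun _ hy => mem_trCl.2 fun _ _ h => h hy

theorem isTransitive_trCl (x : ZFSet.{u}) : (trCl x).IsTransitive := fun _ hy _ hz =>
  mem_trCl.2 fun t ht hx => ht _ (mem_trCl.1 hy t ht hx) hz

/-- `H(κ)`: the sets whose transitive closure has fewer than `κ` elements. -/
def H (κ : Cardinal.{u}) : Set ZFSet.{u} := {x | (trCl x).card < κ}

/-- The rank of a set has at most as many elements as its transitive closure. -/
theorem card_rank_le (x : ZFSet.{u}) : x.rank.card ≤ (trCl x).card := by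
  have key : ∀ z : ZFSet.{u}, z ⊆ trCl x → ∀ o < z.rank, ∃ y ∈ trCl x, y.rank = o := by
    intro z
    induction z using ZFSet.inductionOn with
    | _ z ih =>
      intro hz o ho
      obtain ⟨y, hy, hoy⟩ := ZFSet.lt_rank_iff.1 ho
      rcases hoy.eq_or_lt with h | h
      · exact ⟨y, hz hy, h.symm⟩
      · exact ih y hy (isTransitive_trCl x y (hz hy)) o h
  have hsub : Set.Iio x.rank ⊆ ZFSet.rank '' (trCl x : Set ZFSet.{u}) := by
    intro o ho
    obtain ⟨y, hy, rfl⟩ := key x (subset_trCl x) o ho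
    exact ⟨y, hy, rfl⟩
  have h1 := (Cardinal.mk_le_mk_of_subset hsub).trans Cardinal.mk_image_le
  rw [Cardinal.mk_Iio_ordinal] at h1
  have h2 : #(trCl x : Set ZFSet.{u}) = Cardinal.lift.{u + 1, u} (trCl x).card :=
    ZFSet.cardinalMk_coe_sort
  rw [h2] at h1
  exact Cardinal.lift_le.1 h1

/-- `H(κ)` is a set, not a proper class. -/
instance small_H (κ : Cardinal.{u}) : Small.{u} (H κ) := by
  have : H κ ⊆ ((ZFSet.vonNeumann κ.ord : ZFSet.{u}) : Set ZFSet.{u}) := by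
    intro x hx
    refine ZFSet.mem_vonNeumann.2 (Cardinal.lt_ord.2 ?_)
    exact (card_rank_le x).trans_lt hx
  have : Small.{u} ((ZFSet.vonNeumann κ.ord : ZFSet.{u}) : Set ZFSet.{u}) :=
    ZFSet.small_coe (ZFSet.vonNeumann κ.ord)
  exact small_subset ‹H κ ⊆ _›

/-! ### Elementary substructures of `⟨H(κ), ∈, ⊲⟩` -/

/-- Two binary relation symbols: membership and a well-ordering. -/
inductive SetRel : ℕ → Type
  | mem : SetRel 2
  | wo : SetRel 2

/-- The first-order language with the symbols `∈` and `⊲`. -/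
def setLang : FirstOrder.Language := ⟨fun _ => Empty, SetRel⟩

/-- The universe of the structure `⟨H(κ), ∈, ⊲⟩`, where `⊲` on `H(κ)` is given by `W κ`. -/
def HModel (_W : Cardinal.{u} → ZFSet.{u} → ZFSet.{u} → Prop) (κ : Cardinal.{u}) : Type (u + 1) :=
  {x : ZFSet.{u} // x ∈ H κ}

instance (W : Cardinal.{u} → ZFSet.{u} → ZFSet.{u} → Prop) (κ : Cardinal.{u}) :
    setLang.Structure (HModel W κ) where
  funMap := fun f => Empty.elim f
  RelMap := fun {_} r => match r with
    | SetRel.mem => fun v => (v 0).1 ∈ (v 1).1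
    | SetRel.wo => fun v => W κ (v 0).1 (v 1).1

/-- `N` is a countable elementary substructure of `⟨H(κ), ∈, ⊲⟩`. -/
def IsCtblElem (W : Cardinal.{u} → ZFSet.{u} → ZFSet.{u} → Prop) (κ : Cardinal.{u})
    (N : ZFSet.{u}) : Prop :=
  Set.Countable {x | x ∈ N} ∧
    ∃ S : setLang.ElementarySubstructure (HModel W κ),
      ∀ x : ZFSet.{u}, x ∈ N ↔ ∃ h : x ∈ H κ, (⟨x, h⟩ : HModel W κ) ∈ S

/-- `δ_N = N ∩ ω₁`. -/
noncomputable def delta (N : ZFSet.{u}) : ZFSet.{u} := N ∩ (Ordinal.omega 1).toZFSet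

/-- The set coding the sequence `⟨N ζ : ζ ≤ ξ⟩`, i.e. `{(ζ, N ζ) : ζ ≤ ξ}`. -/
noncomputable def seqUpTo (N : Ordinal.{u} → ZFSet.{u}) (ξ : Ordinal.{u}) : ZFSet.{u} :=
  ZFSet.range fun ζ : Set.Iic ξ => ZFSet.pair ζ.1.toZFSet (N ζ.1)

/-- `⟨N ξ : ξ ≤ α⟩` is an `α`-tower of countable elementary substructures of `H(κ)`. Only the values
of `N` at ordinals `≤ α` matter. -/
structure IsTower (W : Cardinal.{u} → ZFSet.{u} → ZFSet.{u} → Prop) (κ : Cardinal.{u})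
    (α : Ordinal.{u}) (N : Ordinal.{u} → ZFSet.{u}) : Prop where
  elem : ∀ ξ ≤ α, IsCtblElem W κ (N ξ)
  index_mem : α.toZFSet ∈ N 0
  mem_succ : ∀ ζ < α, N ζ ∈ N (ζ + 1)
  limit : ∀ δ ≤ α, Order.IsSuccLimit δ → ∀ x : ZFSet.{u}, x ∈ N δ ↔ ∃ ξ < δ, x ∈ N ξ
  seq_mem : ∀ ξ < α, seqUpTo N ξ ∈ N (ξ + 1)

/-! ### Forcing notions, generic conditions and `α`-properness -/

/-- A forcing notion: a set with a preorder (coded as a set of pairs `(q, p)` with `q ≤ p`) and a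
largest element. -/
structure ForcingNotion where
  carrier : ZFSet.{u}
  rel : ZFSet.{u}
  one : ZFSet.{u}
  rel_sub : ∀ z ∈ rel, ∃ q ∈ carrier, ∃ p ∈ carrier, z = ZFSet.pair q p
  refl : ∀ p ∈ carrier, ZFSet.pair p p ∈ rel
  trans : ∀ p q r : ZFSet.{u}, ZFSet.pair r q ∈ rel → ZFSet.pair q p ∈ rel → ZFSet.pair r p ∈ rel
  one_mem : one ∈ carrier
  le_one : ∀ p ∈ carrier, ZFSet.pair p one ∈ rel

namespace ForcingNotion

/-- The forcing notion `⟨ℙ, ≤, 1⟩` as a set. -/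
def code (P : ForcingNotion.{u}) : ZFSet.{u} :=
  ZFSet.pair P.carrier (ZFSet.pair P.rel P.one)

/-- `q ≤ p` (`q` extends `p`). -/
def le (P : ForcingNotion.{u}) (q p : ZFSet.{u}) : Prop := ZFSet.pair q p ∈ P.rel

/-- `D` is a dense open subset of `ℙ`. -/
def DenseOpen (P : ForcingNotion.{u}) (D : ZFSet.{u}) : Prop :=
  D ⊆ P.carrier ∧ (∀ p ∈ P.carrier, ∃ d ∈ D, P.le d p) ∧ ∀ d ∈ D, ∀ p, P.le p d → p ∈ D

/-- `A` is predense below `q`. -/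
def PredenseBelow (P : ForcingNotion.{u}) (A q : ZFSet.{u}) : Prop :=
  ∀ r, P.le r q → ∃ t ∈ A, ∃ s, P.le s r ∧ P.le s t

/-- `q` is an `(N, ℙ)`-generic condition. -/
def Generic (P : ForcingNotion.{u}) (N q : ZFSet.{u}) : Prop :=
  q ∈ P.carrier ∧ ∀ D ∈ N, P.DenseOpen D → P.PredenseBelow (D ∩ N) q

/-- `κ` is a regular cardinal that is large enough with respect to `ℙ`: `κ > (2 ^ |tr ℙ|)⁺`. -/
def LargeEnough (P : ForcingNotion.{u}) (κ : Cardinal.{u}) : Prop :=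
  κ.IsRegular ∧ Order.succ (2 ^ (trCl P.code).card) < κ

/-- `α`-properness for towers of elementary substructures of `H(κ)`. -/
def AlphaProperAt (P : ForcingNotion.{u}) (W : Cardinal.{u} → ZFSet.{u} → ZFSet.{u} → Prop)
    (κ : Cardinal.{u}) (α : Ordinal.{u}) : Prop :=
  ∀ N : Ordinal.{u} → ZFSet.{u}, IsTower W κ α N → P.code ∈ N 0 →
    ∀ p ∈ P.carrier, p ∈ N 0 → ∃ q, P.le q p ∧ ∀ ξ ≤ α, P.Generic (N ξ) q

/-- `ℙ` is `α`-proper. -/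
def AlphaProper (P : ForcingNotion.{u}) (W : Cardinal.{u} → ZFSet.{u} → ZFSet.{u} → Prop)
    (α : Ordinal.{u}) : Prop :=
  ∀ κ : Cardinal.{u}, κ.IsRegular → P.AlphaProperAt W κ α

/-! ### Names and the forcing relation for atomic formulas -/

/-- The canonical name `x̌ = {(y̌, 1) : y ∈ x}` of `x`. -/
noncomputable def check (P : ForcingNotion.{u}) (x : ZFSet.{u}) : ZFSet.{u} :=
  ZFSet.range fun y : {y : ZFSet.{u} // y ∈ x} => ZFSet.pair (check P y.1) P.one
termination_by x
decreasing_by exact y.2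

theorem rank_fst_lt {a c s : ZFSet.{u}} (h : ZFSet.pair c s ∈ a) : c.rank < a.rank := by
  have h1 : c ∈ ({c} : ZFSet.{u}) := by simp
  have h2 : ({c} : ZFSet.{u}) ∈ ZFSet.pair c s := by simp [ZFSet.pair]
  exact (ZFSet.rank_lt_of_mem h1).trans ((ZFSet.rank_lt_of_mem h2).trans (ZFSet.rank_lt_of_mem h))

/-- `p ⊩ a = b`: for every `(c, s) ∈ a` it is dense below `p` that, if `s` is met, `c` is forced
equal to some member `d` of `b` with `(d, t) ∈ b` and `t` met; and symmetrically. -/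
def ForcesEq (P : ForcingNotion.{u}) (a b p : ZFSet.{u}) : Prop :=
  (∀ c s, ∀ _h : ZFSet.pair c s ∈ a, ∀ q, P.le q p → P.le q s →
    ∃ r, P.le r q ∧ ∃ d t, ZFSet.pair d t ∈ b ∧ P.le r t ∧ ForcesEq P c d r) ∧
  (∀ d t, ZFSet.pair d t ∈ b → ∀ q, P.le q p → P.le q t →
    ∃ r, P.le r q ∧ ∃ c s, ∃ _h : ZFSet.pair c s ∈ a, P.le r s ∧ ForcesEq P c d r)
termination_by a.rank
decreasing_by all_goals exact rank_fst_lt _h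

/-- `p ⊩ a ∈ b`: it is dense below `p` that `a` is forced equal to some `c` with `(c, s) ∈ b`
and `s` met. -/
def ForcesMem (P : ForcingNotion.{u}) (a b p : ZFSet.{u}) : Prop :=
  ∀ q, P.le q p → ∃ r, P.le r q ∧ ∃ c s, ZFSet.pair c s ∈ b ∧ P.le r s ∧ P.ForcesEq a c r

/-- `p ⊩ a ∉ b`: no extension of `p` forces `a ∈ b`. -/
def ForcesNotMem (P : ForcingNotion.{u}) (a b p : ZFSet.{u}) : Prop :=
  ∀ q, P.le q p → ¬ P.ForcesMem a b q

end ForcingNotion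

/-! ### The forcing that adds a club in `ω₁` with finite conditions -/

/-- A condition `⟨⟨M 0, …, M (n - 1)⟩, f⟩`, where `f i` stands for the value `f (M i)`. -/
structure Condition (W : Cardinal.{u} → ZFSet.{u} → ZFSet.{u} → Prop) where
  n : ℕ
  M : Fin n → ZFSet.{u}
  f : Fin n → ZFSet.{u}
  elem : ∀ i, IsCtblElem W (aleph 1) (M i)
  increasing : ∀ i j, i < j → M i ∈ M j
  finite : ∀ i, Set.Finite {x | x ∈ f i}
  subset_H : ∀ i, ∀ x ∈ f i, x ∈ H (aleph 1)
  subset_next : ∀ i j : Fin n, i.1 + 1 = j.1 → f i ⊆ M j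

namespace Condition

variable {W : Cardinal.{u} → ZFSet.{u} → ZFSet.{u} → Prop}

/-- The sequence `ℳ_p` as a set of pairs `(i, M i)`. -/
noncomputable def seq (p : Condition W) : ZFSet.{u} :=
  ZFSet.range fun i : Fin p.n => ZFSet.pair (i.1 : Ordinal.{u}).toZFSet (p.M i)

/-- The function `f_p` as a set of pairs `(M i, f (M i))`. -/
noncomputable def graph (p : Condition W) : ZFSet.{u} :=
  ZFSet.range fun i : Fin p.n => ZFSet.pair (p.M i) (p.f i)

/-- The condition `⟨ℳ_p, f_p⟩` as a set. -/
noncomputable def code (p : Condition W) : ZFSet.{u} := ZFSet.pair p.seq p.graph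

/-- `q ≤ p`: every model `M` of `p` is a model of `q`, and `f_p(M) ⊆ f_q(M)`. -/
def Ext (q p : Condition W) : Prop := ∀ i, ∃ j, q.M j = p.M i ∧ p.f i ⊆ q.f j

theorem ext_iff_graph {q p : Condition W} : Ext q p ↔ ∀ z x, ZFSet.pair z x ∈ p.graph →
    ∃ y, ZFSet.pair z y ∈ q.graph ∧ x ⊆ y := by
  constructor
  · intro h z x hz
    obtain ⟨i, hi⟩ := ZFSet.mem_range.1 hz
    obtain ⟨rfl, rfl⟩ := ZFSet.pair_inj.1 hi
    obtain ⟨j, hj, hs⟩ := h i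
    exact ⟨_, ZFSet.mem_range.2 ⟨j, by rw [hj]⟩, hs⟩
  · intro h i
    obtain ⟨y, hy, hs⟩ := h _ _ (ZFSet.mem_range.2 ⟨i, rfl⟩)
    obtain ⟨j, hj⟩ := ZFSet.mem_range.1 hy
    obtain ⟨h1, rfl⟩ := ZFSet.pair_inj.1 hj
    exact ⟨j, h1, hs⟩

theorem Ext.refl (p : Condition W) : Ext p p := fun i => ⟨i, rfl, fun _ h => h⟩

theorem Ext.trans {r q p : Condition W} (h : Ext r q) (h' : Ext q p) : Ext r p := by
  intro i
  obtain ⟨j, hj, hs⟩ := h' i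
  obtain ⟨k, hk, ht⟩ := h j
  exact ⟨k, hk.trans hj, fun _ hx => ht (hs hx)⟩

theorem graph_eq_of_code_eq {q p : Condition W} (h : q.code = p.code) : q.graph = p.graph :=
  (ZFSet.pair_inj.1 h).2

/-- The condition with no models. -/
def empty (W : Cardinal.{u} → ZFSet.{u} → ZFSet.{u} → Prop) : Condition W where
  n := 0
  M := fun i => i.elim0
  f := fun i => i.elim0
  elem := fun i => i.elim0
  increasing := fun i => i.elim0
  finite := fun i => i.elim0
  subset_H := fun i => i.elim0
  subset_next := fun i => i.elim0

/-- The conditions form a set. -/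
instance : Small.{u} (Condition W) := by
  let e : Condition W → Σ n : ℕ, (Fin n → Set (H.{u} (aleph 1))) × (Fin n → Set (H.{u} (aleph 1))) :=
    fun p => ⟨p.n, fun i => {x | x.1 ∈ p.M i}, fun i => {x | x.1 ∈ p.f i}⟩
  refine small_of_injective (f := e) ?_
  rintro ⟨n, M, f, h1, h2, h3, h4, h5⟩ ⟨n', M', f', h1', h2', h3', h4', h5'⟩ h
  obtain rfl : n = n' := congrArg Sigma.fst h
  have h' := eq_of_heq (Sigma.mk.inj h).2
  have key : ∀ a b : ZFSet.{u}, (∀ x ∈ a, x ∈ H (aleph 1)) → (∀ x ∈ b, x ∈ H (aleph 1)) →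
      {x : H.{u} (aleph 1) | x.1 ∈ a} = {x : H.{u} (aleph 1) | x.1 ∈ b} → a = b := by
    intro a b ha hb hab
    ext x
    exact ⟨fun hx => (Set.ext_iff.1 hab ⟨x, ha x hx⟩).1 hx,
      fun hx => (Set.ext_iff.1 hab ⟨x, hb x hx⟩).2 hx⟩
  have sub : ∀ m : ZFSet.{u}, IsCtblElem W (aleph 1) m → ∀ x ∈ m, x ∈ H (aleph 1) := by
    rintro m ⟨-, S, hS⟩ x hx
    exact ((hS x).1 hx).1
  obtain rfl : M = M' := funext fun i =>
    key _ _ (sub _ (h1 i)) (sub _ (h1' i)) (congrFun (congrArg Prod.fst h') i)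
  obtain rfl : f = f' := funext fun i =>
    key _ _ (h4 i) (h4' i) (congrFun (congrArg Prod.snd h') i)
  rfl

end Condition

/-- The forcing notion `ℙ`. -/
noncomputable def clubForcing (W : Cardinal.{u} → ZFSet.{u} → ZFSet.{u} → Prop) :
    ForcingNotion.{u} where
  carrier := ZFSet.range fun p : Condition W => p.code
  rel := ZFSet.range fun z : {z : Condition W × Condition W // z.1.Ext z.2} =>
    ZFSet.pair z.1.1.code z.1.2.code
  one := (Condition.empty W).code
  rel_sub := by
    intro z hz
    obtain ⟨⟨⟨q, p⟩, h⟩, rfl⟩ := ZFSet.mem_range.1 hz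
    exact ⟨_, ZFSet.mem_range.2 ⟨q, rfl⟩, _, ZFSet.mem_range.2 ⟨p, rfl⟩, rfl⟩
  refl := by
    intro x hx
    obtain ⟨p, rfl⟩ := ZFSet.mem_range.1 hx
    exact ZFSet.mem_range.2 ⟨⟨(p, p), Condition.Ext.refl p⟩, rfl⟩
  trans := by
    intro x y z hzy hyx
    obtain ⟨⟨⟨r, q⟩, h⟩, e⟩ := ZFSet.mem_range.1 hzy
    obtain ⟨⟨⟨q', p⟩, h'⟩, e'⟩ := ZFSet.mem_range.1 hyx
    obtain ⟨rfl, rfl⟩ := ZFSet.pair_inj.1 e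
    obtain ⟨e1, rfl⟩ := ZFSet.pair_inj.1 e'
    have h'' : Condition.Ext q p := by
      rw [Condition.ext_iff_graph] at h' ⊢
      rwa [← Condition.graph_eq_of_code_eq e1]
    exact ZFSet.mem_range.2 ⟨⟨(r, p), h.trans h''⟩, rfl⟩
  one_mem := ZFSet.mem_range.2 ⟨_, rfl⟩
  le_one := by
    intro x hx
    obtain ⟨p, rfl⟩ := ZFSet.mem_range.1 hx
    exact ZFSet.mem_range.2 ⟨⟨(p, Condition.empty W), fun i => i.elim0⟩, rfl⟩

/-- The canonical name `Ċ = {(δ̌_M, p) : p ∈ ℙ, M ∈ ℳ_p}` of the generic club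
`C = {δ_M : M ∈ ℳ_p for some p ∈ G}`. -/
noncomputable def clubName (W : Cardinal.{u} → ZFSet.{u} → ZFSet.{u} → Prop) : ZFSet.{u} :=
  ZFSet.range fun z : (Σ p : Condition W, Fin p.n) =>
    ZFSet.pair ((clubForcing W).check (delta (z.1.M z.2))) z.1.code

end ClubForcing

/-! A promise `f M` must belong to every model above `M`, and this can exclude a whole initial
segment of candidates. Let `N n` be the finite stages of an `ω`-tower, let `Δ` be the set of
countable ordinals in their union, and let `q` be a condition.

Suppose some extension `r` of `q` has a model that omits part of `Δ`. Let `M` be the topmost such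
model of `r`, and choose `η ∈ Δ` outside `M`, say `η ∈ N m`, and a countable ordinal `ξ` in `N (m +
1)` but not in `N m`. All models of `r` above `M` include `Δ`, so `ξ` may be added to the promise at
`M`. In any further extension, a model containing `η` cannot be `M` or lie below it, since such
models are included in `M`. It therefore lies above `M` and contains `ξ`. If no extension has such a
model `M`, then every model of every extension includes `Δ`, and `m = 0` works with any `η`. This is
`Condition.exists_ext_avoiding`.

Both assertions about towers follow. A model `K` with `delta K = delta (N m)` would contain `η` but
not `ξ`, so the extension forces `delta (N m)` out of the club (`IsTower.exists_forcesNotMem`). If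
`q` were generic for `N m`, genericity applied to the dense open set of conditions having a model
that contains `η` would yield a compatible condition with such a model in `N m`. Being countable,
that model is included in `N m` and omits `ξ` (`exists_model_subset_of_generic`,
`IsTower.not_exists_generic`). Failure of `ω`-properness then needs only the existence of towers
(`exists_isTower`).

Elementarity enters through `FODef`, a calculus of first-order definable relations that replaces
explicit formulas. -/

namespace ClubForcing

open Cardinal Ordinal FirstOrder

/-! ### Closure properties of first-order definable relations -/

section Definability

variable {L : Language} {M : Type*} [L.Structure M] {α : Type*}

/-- `P` is defined by a first-order formula without parameters. -/
def FODef (L : Language) {M : Type*} [L.Structure M] {α : Type*} (P : (α → M) → Prop) : Prop :=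
  ∃ φ : L.Formula α, ∀ v, φ.Realize v ↔ P v

namespace FODef

variable {P Q : (α → M) → Prop}

theorem eq (i j : α) : FODef L fun v : α → M => v i = v j :=
  ⟨(Language.Term.var i).equal (Language.Term.var j), fun v => by simp⟩

theorem imp (hP : FODef L P) (hQ : FODef L Q) : FODef L fun v => P v → Q v := by
  obtain ⟨φ, hφ⟩ := hP
  obtain ⟨ψ, hψ⟩ := hQ
  exact ⟨φ.imp ψ, fun v => by simp [hφ, hψ]⟩

theorem not (hP : FODef L P) : FODef L fun v => ¬ P v := by
  obtain ⟨φ, hφ⟩ := hP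
  exact ⟨φ.not, fun v => by simp [hφ]⟩

theorem and (hP : FODef L P) (hQ : FODef L Q) : FODef L fun v => P v ∧ Q v := by
  obtain ⟨φ, hφ⟩ := hP
  obtain ⟨ψ, hψ⟩ := hQ
  exact ⟨φ ⊓ ψ, fun v => by simp [hφ, hψ]⟩

theorem or (hP : FODef L P) (hQ : FODef L Q) : FODef L fun v => P v ∨ Q v := by
  obtain ⟨φ, hφ⟩ := hP
  obtain ⟨ψ, hψ⟩ := hQ
  exact ⟨φ ⊔ ψ, fun v => by simp [hφ, hψ]⟩

theorem iff (hP : FODef L P) (hQ : FODef L Q) : FODef L fun v => (P v ↔ Q v) := by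
  obtain ⟨φ, hφ⟩ := hP
  obtain ⟨ψ, hψ⟩ := hQ
  exact ⟨φ.iff ψ, fun v => by simp [hφ, hψ]⟩

/-- `Option α` is the context `α` with one more variable: `none` is the variable being bound, and
nested quantifiers shift the older variables by `some`. -/
theorem ex {R : (α → M) → M → Prop}
    (hR : FODef L fun w : Option α → M => R (fun a => w (some a)) (w none)) :
    FODef L fun v => ∃ x, R v x := by
  obtain ⟨φ, hφ⟩ := hR
  refine ⟨(φ.relabel fun o : Option α => o.elim (Sum.inr ()) Sum.inl).iExs Unit, fun v => ?_⟩
  rw [Language.Formula.realize_iExs]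
  simp only [Language.Formula.realize_relabel, hφ]
  exact ⟨fun ⟨i, hi⟩ => ⟨i (), hi⟩, fun ⟨x, hx⟩ => ⟨fun _ => x, hx⟩⟩

theorem all {R : (α → M) → M → Prop}
    (hR : FODef L fun w : Option α → M => R (fun a => w (some a)) (w none)) :
    FODef L fun v => ∀ x, R v x := by
  have := (ex (R := fun v x => ¬ R v x) hR.not).not
  simpa only [not_exists, not_not] using this

/-- An elementary substructure contains a witness for every definable property, with parameters in
the substructure, that has a witness. -/
theorem exists_mem_elementarySubstructure (S : L.ElementarySubstructure M)
    {R : (α → M) → M → Prop}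
    (hR : FODef L fun w : Option α → M => R (fun a => w (some a)) (w none)) (v : α → M)
    (hv : ∀ a, v a ∈ S) (h : ∃ x, R v x) : ∃ x ∈ S, R v x := by
  obtain ⟨φ, hφ⟩ := hR
  let ψ := (φ.relabel fun o : Option α => o.elim (Sum.inr ()) Sum.inl).iExs Unit
  let v' : α → S := fun a => ⟨v a, hv a⟩
  have h1 : ψ.Realize v := by
    obtain ⟨x, hx⟩ := h
    rw [Language.Formula.realize_iExs]
    refine ⟨fun _ => x, ?_⟩
    rw [Language.Formula.realize_relabel, hφ]
    exact hx
  have h2 : ψ.Realize v' := (S.subtype.map_formula ψ v').1 h1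
  rw [Language.Formula.realize_iExs] at h2
  obtain ⟨i, hi⟩ := h2
  rw [Language.Formula.realize_relabel] at hi
  have h3 := (S.subtype.map_formula φ _).2 hi
  rw [hφ] at h3
  exact ⟨i (), (i ()).2, h3⟩

end FODef

end Definability

/-! ### Sets in `H(κ)` -/

theorem trCl_subset {x t : ZFSet.{u}} (ht : t.IsTransitive) (h : x ⊆ t) : trCl x ⊆ t :=
  fun _ hy => mem_trCl.1 hy t ht h

theorem trCl_mono {x y : ZFSet.{u}} (h : x ⊆ y) : trCl x ⊆ trCl y :=
  trCl_subset (isTransitive_trCl y) fun _ hz => subset_trCl y (h hz)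

theorem mem_H_of_subset {κ : Cardinal.{u}} {x y : ZFSet.{u}} (h : x ⊆ y) (hy : y ∈ H κ) :
    x ∈ H κ :=
  (ZFSet.card_mono (trCl_mono h)).trans_lt hy

theorem mem_H_of_mem {κ : Cardinal.{u}} {x y : ZFSet.{u}} (h : x ∈ y) (hy : y ∈ H κ) :
    x ∈ H κ :=
  (ZFSet.card_mono (trCl_subset (isTransitive_trCl y)
    (isTransitive_trCl y x (subset_trCl y h)))).trans_lt hy

theorem H_mono {κ μ : Cardinal.{u}} (h : κ ≤ μ) : H κ ⊆ H μ := fun _ hx => hx.trans_le h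

/-- A countable set of elements of `H(κ)` is an element of `H(κ)`. -/
theorem range_mem_H {κ : Cardinal.{u}} (hκ : κ.IsRegular) (hκ' : ℵ₀ < κ) {ι : Type} [Countable ι]
    (g : ι → ZFSet.{u}) (hg : ∀ i, g i ∈ H κ) : ZFSet.range g ∈ H κ := by
  -- `t i` is the transitive closure of `{g i}`. The union of the `t i` is transitive, and
  -- regularity of `κ` keeps it smaller than `κ`.
  let t : ι → ZFSet.{u} := fun i => insert (g i) (trCl (g i))
  have hsub : trCl (ZFSet.range g) ⊆ ZFSet.iUnion t := by
    refine trCl_subset ?_ ?_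
    · refine ZFSet.IsTransitive.iUnion fun i => ?_
      intro y hy z hz
      rcases ZFSet.mem_insert_iff.1 hy with rfl | hy
      · exact ZFSet.mem_insert_of_mem _ (subset_trCl _ hz)
      · exact ZFSet.mem_insert_of_mem _ (isTransitive_trCl _ y hy hz)
    · intro y hy
      obtain ⟨i, rfl⟩ := ZFSet.mem_range.1 hy
      exact ZFSet.mem_iUnion.2 ⟨i, ZFSet.mem_insert _ _⟩
  refine (ZFSet.card_mono hsub).trans_lt ?_
  have h1 := ZFSet.lift_card_iUnion_le_sum_card (f := t)
  have h2 : Cardinal.sum (fun i => (t i).card) < κ := by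
    refine Cardinal.sum_lt_lift_of_isRegular hκ ?_ fun i => ?_
    · exact (Cardinal.lift_le_aleph0.2 (Cardinal.mk_le_aleph0 (α := ι))).trans_lt hκ'
    · refine ZFSet.card_insert_le.trans_lt ?_
      exact Cardinal.add_lt_of_lt hκ.1 (hg i) (Cardinal.one_lt_aleph0.trans hκ')
  simpa using h1.trans_lt (by simpa using h2)

theorem mem_H_of_countable {κ : Cardinal.{u}} (hκ : κ.IsRegular) (hκ' : ℵ₀ < κ) {x : ZFSet.{u}}
    (hx : Set.Countable {y | y ∈ x}) (h : ∀ y ∈ x, y ∈ H κ) : x ∈ H κ := by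
  rcases Set.eq_empty_or_nonempty {y | y ∈ x} with h0 | h0
  · have : x = ZFSet.range (fun i : Empty => (i.elim : ZFSet.{u})) := by
      ext y
      simpa using fun hy => (Set.ext_iff.1 h0 y).1 hy
    rw [this]
    exact range_mem_H hκ hκ' _ fun i => i.elim
  · obtain ⟨g, hg⟩ := hx.exists_eq_range h0
    have : x = ZFSet.range g := by
      ext y
      rw [ZFSet.mem_range]
      exact Set.ext_iff.1 hg y
    rw [this]
    refine range_mem_H hκ hκ' _ fun i => h _ ?_
    exact (Set.ext_iff.1 hg (g i)).2 ⟨i, rfl⟩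

theorem pair_mem_H {κ : Cardinal.{u}} (hκ : κ.IsRegular) (hκ' : ℵ₀ < κ) {x y : ZFSet.{u}}
    (hx : x ∈ H κ) (hy : y ∈ H κ) : ZFSet.pair x y ∈ H κ := by
  have h2 : ∀ a b : ZFSet.{u}, a ∈ H κ → b ∈ H κ → ({a, b} : ZFSet.{u}) ∈ H κ := by
    intro a b ha hb
    refine mem_H_of_countable hκ hκ' ?_ ?_
    · refine ((Set.finite_singleton b).insert a).countable.mono fun z hz => ?_
      simpa using hz
    · intro z hz
      rcases ZFSet.mem_pair.1 hz with rfl | rfl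
      exacts [ha, hb]
  rw [ZFSet.pair, ← ZFSet.pair_eq_singleton]
  exact h2 _ _ (h2 _ _ hx hx) (h2 _ _ hx hy)

theorem fst_mem_H {κ : Cardinal.{u}} {x y : ZFSet.{u}} (h : ZFSet.pair x y ∈ H κ) : x ∈ H κ :=
  mem_H_of_mem (y := {x}) (by simp) (mem_H_of_mem (by simp [ZFSet.pair]) h)

theorem snd_mem_H {κ : Cardinal.{u}} {x y : ZFSet.{u}} (h : ZFSet.pair x y ∈ H κ) : y ∈ H κ :=
  mem_H_of_mem (y := {x, y}) (by simp) (mem_H_of_mem (by simp [ZFSet.pair]) h)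

theorem mem_H_aleph_one_of_countable {x : ZFSet.{u}} (hx : Set.Countable {y | y ∈ x})
    (h : ∀ y ∈ x, y ∈ H (aleph 1)) : x ∈ H (aleph 1) :=
  mem_H_of_countable isRegular_aleph_one aleph0_lt_aleph_one hx h

theorem toZFSet_mem_H_of_countable {o : Ordinal.{u}} (ho : o < omega 1) :
    o.toZFSet ∈ H (aleph.{u} 1) := by
  have : trCl o.toZFSet ⊆ o.toZFSet :=
    trCl_subset (ZFSet.isOrdinal_toZFSet o).isTransitive fun _ h => h
  refine (ZFSet.card_mono this).trans_lt ?_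
  rw [Ordinal.card_toZFSet]
  rwa [← ord_aleph, lt_ord] at ho

/-! ### Set-theoretic notions definable in `H(κ)` -/

section SetDefinability

variable {W : Cardinal.{u} → ZFSet.{u} → ZFSet.{u} → Prop} {κ : Cardinal.{u}} {α : Type*}

namespace FODef

theorem congr {P Q : (α → HModel W κ) → Prop} (h : FODef setLang P) (hPQ : ∀ v, P v ↔ Q v) :
    FODef setLang Q := by
  obtain ⟨φ, hφ⟩ := h
  exact ⟨φ, fun v => (hφ v).trans (hPQ v)⟩

theorem mem (i j : α) : FODef setLang fun v : α → HModel W κ => (v i).1 ∈ (v j).1 := by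
  let r : setLang.Relations 2 := SetRel.mem
  refine ⟨r.formula₂ (Language.Term.var i) (Language.Term.var j), fun v => ?_⟩
  exact Language.Formula.realize_rel₂.trans Iff.rfl

/-- Since `H κ` is transitive, a bounded quantifier has the same meaning in `H κ` as in the
universe. The definability lemmas that follow rest on this absoluteness. -/
theorem subset (i j : α) : FODef setLang fun v : α → HModel W κ => (v i).1 ⊆ (v j).1 := by
  refine congr (all (R := fun v x => x.1 ∈ (v i).1 → x.1 ∈ (v j).1)
    ((mem none (some i)).imp (mem none (some j)))) fun v => ?_
  exact ⟨fun h x hx => h ⟨x, mem_H_of_mem hx (v i).2⟩ hx, fun h x hx => h hx⟩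

theorem eq_empty (i : α) : FODef setLang fun v : α → HModel W κ => (v i).1 = ∅ := by
  refine congr (all (R := fun v x => ¬ x.1 ∈ (v i).1) (mem none (some i)).not) fun v => ?_
  rw [ZFSet.eq_empty]
  exact ⟨fun h x hx => h ⟨x, mem_H_of_mem hx (v i).2⟩ hx, fun h x hx => h x.1 hx⟩

theorem eq_insert_self (i j : α) :
    FODef setLang fun v : α → HModel W κ => (v i).1 = insert (v j).1 (v j).1 := by
  refine congr (all (R := fun v x => x.1 ∈ (v i).1 ↔ x = v j ∨ x.1 ∈ (v j).1)
    ((mem none (some i)).iff ((FODef.eq none (some j)).or (mem none (some j))))) fun v => ?_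
  constructor
  · intro h
    ext x
    rw [ZFSet.mem_insert_iff]
    constructor
    · intro hx
      have := (h ⟨x, mem_H_of_mem hx (v i).2⟩).1 hx
      exact this.imp (fun e => congrArg Subtype.val e) id
    · rintro (rfl | hx)
      · exact (h (v j)).2 (Or.inl rfl)
      · exact (h ⟨x, mem_H_of_mem hx (v j).2⟩).2 (Or.inr hx)
  · intro h x
    rw [h, ZFSet.mem_insert_iff]
    exact or_congr_left (Subtype.ext_iff).symm

theorem eq_upair (i j k : α) :
    FODef setLang fun v : α → HModel W κ => (v i).1 = {(v j).1, (v k).1} := by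
  refine congr (all (R := fun v x => x.1 ∈ (v i).1 ↔ x = v j ∨ x = v k)
    ((mem none (some i)).iff ((FODef.eq none (some j)).or (FODef.eq none (some k)))))
    fun v => ?_
  constructor
  · intro h
    ext x
    rw [ZFSet.mem_pair]
    constructor
    · intro hx
      have := (h ⟨x, mem_H_of_mem hx (v i).2⟩).1 hx
      exact this.imp (fun e => congrArg Subtype.val e) (fun e => congrArg Subtype.val e)
    · rintro (rfl | rfl)
      · exact (h (v j)).2 (Or.inl rfl)
      · exact (h (v k)).2 (Or.inr rfl)
  · intro h x
    rw [h, ZFSet.mem_pair]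
    exact or_congr (Subtype.ext_iff).symm (Subtype.ext_iff).symm

theorem eq_pair (i j k : α) :
    FODef setLang fun v : α → HModel W κ => (v i).1 = ZFSet.pair (v j).1 (v k).1 := by
  refine congr (ex (R := fun v s => ∃ t : HModel W κ, (v i).1 = {s.1, t.1} ∧
      s.1 = {(v j).1, (v j).1} ∧ t.1 = {(v j).1, (v k).1})
    (ex ((eq_upair (some (some i)) (some none) none).and
      ((eq_upair (some none) (some (some j)) (some (some j))).and
        (eq_upair none (some (some j)) (some (some k))))))) fun v => ?_
  have hp : ZFSet.pair (v j).1 (v k).1 = {{(v j).1, (v j).1}, {(v j).1, (v k).1}} := by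
    rw [ZFSet.pair, ZFSet.pair_eq_singleton]
  rw [hp]
  constructor
  · rintro ⟨s, t, h, hs, ht⟩
    rw [h, hs, ht]
  · intro h
    have hi := (v i).2
    rw [h] at hi
    exact ⟨⟨_, mem_H_of_mem (ZFSet.mem_pair.2 (Or.inl rfl)) hi⟩,
      ⟨_, mem_H_of_mem (ZFSet.mem_pair.2 (Or.inr rfl)) hi⟩, h, rfl, rfl⟩

theorem pair_mem (i j k : α) :
    FODef setLang fun v : α → HModel W κ => ZFSet.pair (v i).1 (v j).1 ∈ (v k).1 := by
  refine congr (ex (R := fun v p => p.1 = ZFSet.pair (v i).1 (v j).1 ∧ p.1 ∈ (v k).1)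
    ((eq_pair none (some i) (some j)).and (mem none (some k)))) fun v => ?_
  constructor
  · rintro ⟨p, hp, h⟩
    rwa [← hp]
  · intro h
    exact ⟨⟨_, mem_H_of_mem h (v k).2⟩, rfl, h⟩

theorem isTransitive (i : α) :
    FODef setLang fun v : α → HModel W κ => (v i).1.IsTransitive := by
  refine congr (all (R := fun v x => x.1 ∈ (v i).1 → x.1 ⊆ (v i).1)
    ((mem none (some i)).imp (subset none (some i)))) fun v => ?_
  exact ⟨fun h x hx => h ⟨x, mem_H_of_mem hx (v i).2⟩ hx, fun h x hx => h _ hx⟩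

theorem isOrdinal (i : α) : FODef setLang fun v : α → HModel W κ => (v i).1.IsOrdinal := by
  refine congr ((isTransitive i).and (all (R := fun v x => x.1 ∈ (v i).1 → x.1.IsTransitive)
    ((mem none (some i)).imp (isTransitive none)))) fun v => ?_
  rw [ZFSet.isOrdinal_iff_forall_mem_isTransitive]
  exact and_congr_right fun _ =>
    ⟨fun h x hx => h ⟨x, mem_H_of_mem hx (v i).2⟩ hx, fun h x hx => h _ hx⟩

end FODef

/-- A set is inductive if it contains `∅` and is closed under successors. -/
def Inductive (w : ZFSet.{u}) : Prop := ∅ ∈ w ∧ ∀ n ∈ w, insert n n ∈ w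

theorem FODef.inductive (i : α) : FODef setLang fun v : α → HModel W κ => Inductive (v i).1 := by
  refine congr ((ex (R := fun v e => e.1 = ∅ ∧ e.1 ∈ (v i).1)
    ((eq_empty none).and (mem none (some i)))).and
    (all (R := fun v n => n.1 ∈ (v i).1 → ∃ s : HModel W κ, s.1 = insert n.1 n.1 ∧ s.1 ∈ (v i).1)
      ((mem none (some i)).imp (ex ((eq_insert_self none (some none)).and
        (mem none (some (some i)))))))) fun v => ?_
  refine and_congr ⟨?_, fun h => ⟨⟨∅, mem_H_of_mem h (v i).2⟩, rfl, h⟩⟩ ⟨?_, ?_⟩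
  · rintro ⟨e, he, h⟩
    rwa [← he]
  · intro h n hn
    obtain ⟨s, hs, h'⟩ := h ⟨n, mem_H_of_mem hn (v i).2⟩ hn
    rwa [← hs]
  · intro h n hn
    exact ⟨⟨_, mem_H_of_mem (h _ hn) (v i).2⟩, rfl, h _ hn⟩

theorem inductive_omega : Inductive (omega0.{u}).toZFSet := by
  refine ⟨?_, ?_⟩
  · rw [← Ordinal.toZFSet_zero, Ordinal.toZFSet_mem_toZFSet_iff]
    exact omega0_pos
  · intro n hn
    obtain ⟨a, ha, rfl⟩ := Ordinal.mem_toZFSet_iff.1 hn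
    rw [← Ordinal.toZFSet_add_one, Ordinal.toZFSet_mem_toZFSet_iff]
    exact Order.IsSuccLimit.add_one_lt isSuccLimit_omega0 ha

theorem Inductive.omega_subset {w : ZFSet.{u}} (h : Inductive w) : (omega0.{u}).toZFSet ⊆ w := by
  intro n hn
  obtain ⟨a, ha, rfl⟩ := Ordinal.mem_toZFSet_iff.1 hn
  obtain ⟨n, rfl⟩ := lt_omega0.1 ha
  clear hn ha
  induction n with
  | zero => simpa using h.1
  | succ n ih =>
    rw [Nat.cast_add, Nat.cast_one, Ordinal.toZFSet_add_one]
    exact h.2 _ ih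

theorem omega_mem_H (hκ : aleph 1 ≤ κ) : (omega0.{u}).toZFSet ∈ H κ :=
  H_mono hκ (toZFSet_mem_H_of_countable (omega0_lt_omega_one))

end SetDefinability

/-! ### Countable elementary substructures -/

namespace IsCtblElem

variable {W : Cardinal.{u} → ZFSet.{u} → ZFSet.{u} → Prop} {κ : Cardinal.{u}} {N : ZFSet.{u}}

theorem mem_H (h : IsCtblElem W κ N) {x : ZFSet.{u}} (hx : x ∈ N) : x ∈ H κ := by
  obtain ⟨-, S, hS⟩ := h
  exact ((hS x).1 hx).1

/-- The form in which elementarity is used from here on. In particular, an object uniquely definable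
in `H κ` from parameters in `N` belongs to `N`. -/
theorem exists_mem (h : IsCtblElem W κ N) {α : Type*}
    {R : (α → HModel W κ) → HModel W κ → Prop}
    (hR : FODef setLang fun w : Option α → HModel W κ => R (fun a => w (some a)) (w none))
    (v : α → HModel W κ) (hv : ∀ a, (v a).1 ∈ N) (hex : ∃ x, R v x) : ∃ x, x.1 ∈ N ∧ R v x := by
  obtain ⟨-, S, hS⟩ := h
  obtain ⟨x, hx, hR⟩ := FODef.exists_mem_elementarySubstructure S hR v
    (fun a => ((hS _).1 (hv a)).2) hex
  exact ⟨x, (hS _).2 ⟨x.2, hx⟩, hR⟩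

/-- In `H κ`, `ω` is definable as the least inductive set. -/
theorem omega_mem (h : IsCtblElem W κ N) (hκ : aleph 1 ≤ κ) : (omega0.{u}).toZFSet ∈ N := by
  obtain ⟨w, hw, h1, h2⟩ := h.exists_mem (α := Empty)
    (R := fun _ w => Inductive w.1 ∧ ∀ w' : HModel W κ, Inductive w'.1 → w.1 ⊆ w'.1)
    ((FODef.inductive none).and (FODef.all ((FODef.inductive none).imp
      (FODef.subset (some none) none)))) (fun a => a.elim) (fun a => a.elim)
    ⟨⟨_, omega_mem_H hκ⟩, inductive_omega, fun w' h => h.omega_subset⟩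
  have : w.1 = (omega0.{u}).toZFSet := by
    ext x
    exact ⟨fun hx => h2 ⟨_, omega_mem_H hκ⟩ inductive_omega hx, fun hx => h1.omega_subset hx⟩
  rwa [← this]

theorem omega_subset (h : IsCtblElem W κ N) (hκ : aleph 1 ≤ κ) :
    ∀ x ∈ (omega0.{u}).toZFSet, x ∈ N := by
  have hH : ∀ x ∈ (omega0.{u}).toZFSet, x ∈ H κ := fun x hx => mem_H_of_mem hx (omega_mem_H hκ)
  let w : ZFSet.{u} := (omega0.{u}).toZFSet ∩ N
  suffices hw : Inductive w from fun x hx => (ZFSet.mem_inter.1 (hw.omega_subset hx)).2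
  refine ⟨ZFSet.mem_inter.2 ⟨inductive_omega.1, ?_⟩, fun n hn => ?_⟩
  · obtain ⟨e, he, h1⟩ := h.exists_mem (α := Empty) (R := fun _ e => e.1 = ∅)
      (FODef.eq_empty none) (fun a => a.elim) (fun a => a.elim)
      ⟨⟨∅, hH _ inductive_omega.1⟩, rfl⟩
    rwa [← h1]
  · obtain ⟨h1, h2⟩ := ZFSet.mem_inter.1 hn
    refine ZFSet.mem_inter.2 ⟨inductive_omega.2 n h1, ?_⟩
    obtain ⟨s, hs, h3⟩ := h.exists_mem (α := Unit) (R := fun v s => s.1 = insert (v ()).1 (v ()).1)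
      (FODef.eq_insert_self none (some ())) (fun _ => ⟨n, hH _ h1⟩) (fun _ => h2)
      ⟨⟨_, hH _ (inductive_omega.2 n h1)⟩, rfl⟩
    rwa [← h3]

end IsCtblElem

/-- Countable elements of an elementary substructure of `H(κ)` are included in it. -/
theorem IsCtblElem.subset_of_mem {W : Cardinal.{u} → ZFSet.{u} → ZFSet.{u} → Prop}
    {κ : Cardinal.{u}} {N x : ZFSet.{u}} (h : IsCtblElem W κ N) (hreg : κ.IsRegular)
    (hκ : aleph 1 ≤ κ) (hx : x ∈ N) (hxc : Set.Countable {y | y ∈ x}) : x ⊆ N := by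
  rcases Set.eq_empty_or_nonempty {y | y ∈ x} with h0 | h0
  · exact fun y hy => ((Set.ext_iff.1 h0 y).1 hy).elim
  obtain ⟨g, hg⟩ := hxc.exists_eq_range h0
  have hg1 : ∀ n, g n ∈ x := fun n => (Set.ext_iff.1 hg _).2 ⟨n, rfl⟩
  have hg2 : ∀ y ∈ x, ∃ n, g n = y := fun y hy => (Set.ext_iff.1 hg y).1 hy
  have hn : ∀ n : ℕ, (n : Ordinal.{u}).toZFSet ∈ (omega0.{u}).toZFSet := fun n =>
    Ordinal.toZFSet_mem_toZFSet_iff.2 (natCast_lt_omega0 n)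
  -- An enumeration of `x`, coded as a set of `H κ`. Elementarity replaces it by a single-valued `f
  -- ∈ N` that takes every element of `x` as a value on `ω`. As `ω ⊆ N`, each such value is
  -- definable from members of `N`.
  let f₀ : ZFSet.{u} := ZFSet.range fun n : ℕ => ZFSet.pair (n : Ordinal.{u}).toZFSet (g n)
  have hκ' : ℵ₀ < κ := aleph0_lt_aleph_one.trans_le hκ
  have hf₀ : f₀ ∈ H κ := range_mem_H hreg hκ' _ fun n => pair_mem_H hreg hκ'
    (mem_H_of_mem (hn n) (omega_mem_H hκ)) (mem_H_of_mem (hg1 n) (h.mem_H hx))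
  obtain ⟨f, hf, h1, h2⟩ := h.exists_mem (α := Bool)
    (R := fun v f => (∀ y : HModel W κ, y.1 ∈ (v true).1 → ∃ n : HModel W κ, n.1 ∈ (v false).1 ∧
        ZFSet.pair n.1 y.1 ∈ f.1) ∧ ∀ n y z : HModel W κ, ZFSet.pair n.1 y.1 ∈ f.1 →
        ZFSet.pair n.1 z.1 ∈ f.1 → y = z)
    ((FODef.all ((FODef.mem none (some (some true))).imp
      (FODef.ex ((FODef.mem none (some (some (some false)))).and
        (FODef.pair_mem none (some none) (some (some none))))))).and
      (FODef.all (FODef.all (FODef.all ((FODef.pair_mem (some (some none)) (some none)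
        (some (some (some none)))).imp ((FODef.pair_mem (some (some none)) none
        (some (some (some none)))).imp (FODef.eq (some none) none)))))))
    (fun b => bif b then ⟨x, h.mem_H hx⟩ else ⟨_, omega_mem_H hκ⟩)
    (by rintro (_ | _); exacts [h.omega_mem hκ, hx])
    ⟨⟨f₀, hf₀⟩, by
      rintro y hy
      obtain ⟨n, hny⟩ := hg2 _ hy
      refine ⟨⟨_, mem_H_of_mem (hn n) (omega_mem_H hκ)⟩, hn n, ?_⟩
      exact ZFSet.mem_range.2 ⟨n, by rw [hny]⟩, by
      intro n y z hy hz
      obtain ⟨k, hk⟩ := ZFSet.mem_range.1 hy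
      obtain ⟨l, hl⟩ := ZFSet.mem_range.1 hz
      obtain ⟨hk1, hk2⟩ := ZFSet.pair_inj.1 hk
      obtain ⟨hl1, hl2⟩ := ZFSet.pair_inj.1 hl
      have := Ordinal.toZFSet_injective (hk1.trans hl1.symm)
      obtain rfl : k = l := by exact_mod_cast this
      exact Subtype.ext (hk2.symm.trans hl2)⟩
  intro y hy
  obtain ⟨n, hnω, hny⟩ := h1 ⟨y, mem_H_of_mem hy (h.mem_H hx)⟩ hy
  obtain ⟨z, hzN, hz⟩ := h.exists_mem (α := Bool)
    (R := fun v z => ZFSet.pair (v false).1 z.1 ∈ (v true).1)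
    (FODef.pair_mem (some false) none (some true)) (fun b => bif b then f else n)
    (by rintro (_ | _); exacts [h.omega_subset hκ _ hnω, hf]) ⟨_, hny⟩
  have := h2 n _ z hny hz
  rw [← this] at hzN
  exact hzN

theorem toZFSet_mem_omega_one {o : Ordinal.{u}} (ho : Set.Countable {y | y ∈ o.toZFSet}) :
    o.toZFSet ∈ (Ordinal.omega.{u} 1).toZFSet := by
  rw [Ordinal.toZFSet_mem_toZFSet_iff, ← ord_aleph, lt_ord, ← Ordinal.card_toZFSet, ← succ_aleph0,
    Order.lt_succ_iff]
  have h3 : #(o.toZFSet : Set ZFSet.{u}) ≤ ℵ₀ := Cardinal.le_aleph0_iff_set_countable.2 ho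
  rw [show #(o.toZFSet : Set ZFSet.{u}) = lift.{u + 1, u} o.toZFSet.card from
    ZFSet.cardinalMk_coe_sort, lift_le_aleph0] at h3
  exact h3

/-- If `N ∈ N' ≺ H(κ)` with `N` countable, then some countable ordinal is in `N'` but not in
`N`. -/
theorem IsCtblElem.exists_mem_omega_one_not_mem
    {W : Cardinal.{u} → ZFSet.{u} → ZFSet.{u} → Prop}
    {κ : Cardinal.{u}} {N N' : ZFSet.{u}} (h : IsCtblElem W κ N') (hκ : aleph 1 ≤ κ)
    (hN : N ∈ N') (hc : Set.Countable {x | x ∈ N}) :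
    ∃ ξ ∈ N', ξ ∉ N ∧ ξ ∈ (Ordinal.omega.{u} 1).toZFSet := by
  -- The witness is the least ordinal outside `N`. It is included in the countable set `N`, hence is
  -- itself countable, and it is definable from `N`.
  obtain ⟨ρ, hρ, h1, h2, h3⟩ := h.exists_mem (α := Unit)
    (R := fun v ρ => ρ.1.IsOrdinal ∧ ¬ ρ.1 ∈ (v ()).1 ∧ ρ.1 ⊆ (v ()).1)
    ((FODef.isOrdinal none).and ((FODef.mem none (some ())).not.and
      (FODef.subset none (some ())))) (fun _ => ⟨N, h.mem_H hN⟩) (fun _ => hN) (by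
      have hne : ∃ o : Ordinal.{u}, o.toZFSet ∉ N :=
        ⟨N.rank, fun hN => (ZFSet.rank_lt_of_mem hN).ne (by rw [Ordinal.rank_toZFSet])⟩
      obtain ⟨o, ho, hmin⟩ := WellFounded.has_min (wellFounded_lt (α := Ordinal.{u}))
        {o | o.toZFSet ∉ N} hne
      have hsub : o.toZFSet ⊆ N := by
        intro x hx
        obtain ⟨a, ha, rfl⟩ := Ordinal.mem_toZFSet_iff.1 hx
        by_contra hcon
        exact hmin a hcon ha
      have ho1 := toZFSet_mem_omega_one (hc.mono fun x hx => hsub hx)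
      refine ⟨⟨o.toZFSet, H_mono hκ (toZFSet_mem_H_of_countable
        (Ordinal.toZFSet_mem_toZFSet_iff.1 ho1))⟩, ZFSet.isOrdinal_toZFSet o, ho, hsub⟩)
  refine ⟨ρ.1, hρ, h2, ?_⟩
  have := toZFSet_mem_omega_one (o := ρ.1.rank)
    (hc.mono fun x hx => h3 (by rwa [Set.mem_ofPred_eq, h1.toZFSet_rank_eq] at hx))
  rwa [h1.toZFSet_rank_eq] at this

/-! ### Existence of countable elementary substructures and of towers -/

section Existence

variable {W : Cardinal.{u} → ZFSet.{u} → ZFSet.{u} → Prop} {κ : Cardinal.{u}}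

theorem card_setLang_le : setLang.card ≤ ℵ₀ := by
  have h1 : Countable (Σ l, setLang.Functions l) :=
    ⟨fun x => Empty.elim x.2, fun x => Empty.elim x.2⟩
  have h2 : Countable (Σ l, setLang.Relations l) := by
    let g : Bool → Σ l, setLang.Relations l :=
      fun b => bif b then ⟨2, SetRel.mem⟩ else ⟨2, SetRel.wo⟩
    refine Function.Surjective.countable (f := g) ?_
    rintro ⟨_, _ | _⟩
    exacts [⟨true, rfl⟩, ⟨false, rfl⟩]
  have : Countable setLang.Symbols := by unfold Language.Symbols; infer_instance
  exact Cardinal.mk_le_aleph0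

/-- Every countable subset of `H(κ)` is included in a countable elementary substructure. -/
theorem exists_isCtblElem (W : Cardinal.{u} → ZFSet.{u} → ZFSet.{u} → Prop) (hκ : aleph 1 ≤ κ)
    {X : Set ZFSet.{u}} (hX : X.Countable) (hXH : X ⊆ H κ) :
    ∃ N, IsCtblElem W κ N ∧ ∀ x ∈ X, x ∈ N := by
  have hinf : ℵ₀ ≤ #(HModel W κ) := by
    let g : ℕ → HModel W κ := fun n => ⟨(n : Ordinal.{u}).toZFSet,
      mem_H_of_mem (Ordinal.toZFSet_mem_toZFSet_iff.2 (natCast_lt_omega0 n)) (omega_mem_H hκ)⟩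
    have hg : Function.Injective g := by
      intro m n h
      have := Ordinal.toZFSet_injective (congrArg Subtype.val h)
      exact_mod_cast this
    have : Infinite (HModel W κ) := Infinite.of_injective g hg
    exact Cardinal.aleph0_le_mk _
  let s : Set (HModel W κ) := {x | x.1 ∈ X}
  have hs : s.Countable := hX.preimage Subtype.val_injective
  obtain ⟨S, hsS, hS⟩ := Language.exists_elementarySubstructure_card_eq setLang s
    (ℵ₀ : Cardinal.{u}) le_rfl (by simpa using hs) (by simpa using card_setLang_le)
    (by simpa using hinf)
  have hSc : Countable S := by
    rw [← Cardinal.mk_le_aleph0_iff]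
    simpa using hS.le
  have hsm : Small.{u} S := Countable.toSmall S
  refine ⟨ZFSet.range fun x : S => x.1.1, ⟨?_, S, fun x => ?_⟩, fun x hx => ?_⟩
  · refine (Set.countable_range fun x : S => x.1.1).mono fun x hx => ?_
    exact ZFSet.mem_range.1 hx
  · rw [ZFSet.mem_range]
    constructor
    · rintro ⟨y, rfl⟩
      exact ⟨y.1.2, y.2⟩
    · rintro ⟨h, hx⟩
      exact ⟨⟨_, hx⟩, rfl⟩
  · exact ZFSet.mem_range.2 ⟨⟨⟨x, hXH hx⟩, hsS hx⟩, rfl⟩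

/-- The union of an increasing sequence of countable elementary substructures. -/
theorem IsCtblElem.iUnion {N : ℕ → ZFSet.{u}} (h : ∀ n, IsCtblElem W κ (N n))
    (hN : ∀ n, N n ⊆ N (n + 1)) : IsCtblElem W κ (ZFSet.iUnion N) := by
  have hmono : ∀ {m n}, m ≤ n → N m ⊆ N n := by
    intro m n hmn
    induction hmn with
    | refl => exact fun _ hx => hx
    | step _ ih => exact fun _ hx => hN _ (ih hx)
  have hmem : ∀ x : ZFSet.{u}, x ∈ ZFSet.iUnion N ↔ ∃ n, x ∈ N n := fun x => ZFSet.mem_iUnion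
  refine ⟨(Set.countable_iUnion fun n => (h n).1).mono fun x hx => ?_, ?_⟩
  · exact Set.mem_iUnion.2 ((hmem x).1 hx)
  let S : setLang.Substructure (HModel W κ) :=
    { carrier := {x | x.1 ∈ ZFSet.iUnion N}
      fun_mem := fun f => Empty.elim f }
  have hS : S.IsElementary := by
    -- Tarski–Vaught test: the finitely many parameters already lie in a single `N k`, which
    -- supplies the witness.
    refine S.isElementary_of_exists fun n φ x a hφ => ?_
    have hx : ∀ i, ∃ m, (x i).1.1 ∈ N m := fun i => (hmem _).1 (x i).2
    choose m hm using hx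
    obtain ⟨k, hk⟩ : ∃ k, ∀ i, m i ≤ k := (Set.finite_range m).bddAbove.imp fun k hk i =>
      hk ⟨i, rfl⟩
    obtain ⟨b, hb, hR⟩ := (h k).exists_mem (α := Fin n)
      (R := fun v y => φ.Realize default (Fin.snoc (α := fun _ => HModel W κ) v y))
      ⟨φ.toFormula.relabel
        (Sum.elim Empty.elim (Fin.lastCases (motive := fun _ => Option (Fin n)) none some)),
        fun v => by
          rw [Language.Formula.realize_relabel, Language.BoundedFormula.realize_toFormula]
          refine iff_of_eq ?_
          congr 1
          · exact Subsingleton.elim _ _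
          · funext i
            refine Fin.lastCases ?_ (fun i => ?_) i <;> simp⟩
      (fun i => (x i).1) (fun i => hmono (hk i) (hm i)) ⟨a, hφ⟩
    exact ⟨⟨b, (hmem _).2 ⟨k, hb⟩⟩, hR⟩
  refine ⟨⟨S, hS⟩, fun x => ⟨fun hx => ?_, fun ⟨_, hx⟩ => hx⟩⟩
  obtain ⟨n, hn⟩ := (hmem x).1 hx
  exact ⟨(h n).mem_H hn, hx⟩

theorem mem_seqUpTo {N : Ordinal.{u} → ZFSet.{u}} {ξ : Ordinal.{u}} {z : ZFSet.{u}} :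
    z ∈ seqUpTo N ξ ↔ ∃ ζ ≤ ξ, ZFSet.pair ζ.toZFSet (N ζ) = z := by
  rw [seqUpTo, ZFSet.mem_range]
  simp

theorem insert_mem_H (hκ : κ.IsRegular) (hκ' : ℵ₀ < κ) {x y : ZFSet.{u}} (hx : x ∈ H κ)
    (hy : Set.Countable {z | z ∈ y}) (hyH : y ∈ H κ) : insert x y ∈ H κ := by
  refine mem_H_of_countable hκ hκ' ?_ fun z hz => ?_
  · refine (hy.insert x).mono fun z hz => ?_
    exact ZFSet.mem_insert_iff.1 hz
  · rcases ZFSet.mem_insert_iff.1 hz with rfl | hz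
    exacts [hx, mem_H_of_mem hz hyH]

/-- There are `ω`-towers in `H(κ)` whose first model includes a given countable set. -/
theorem exists_isTower (W : Cardinal.{u} → ZFSet.{u} → ZFSet.{u} → Prop) (hreg : κ.IsRegular)
    (hκ : aleph 1 ≤ κ) {X : Set ZFSet.{u}} (hX : X.Countable) (hXH : X ⊆ H κ) :
    ∃ N : Ordinal.{u} → ZFSet.{u}, IsTower W κ omega0 N ∧ ∀ x ∈ X, x ∈ N 0 := by
  have hκ' : ℵ₀ < κ := aleph0_lt_aleph_one.trans_le hκ
  have hnat : ∀ n : ℕ, (n : Ordinal.{u}).toZFSet ∈ H κ := fun n =>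
    mem_H_of_mem (Ordinal.toZFSet_mem_toZFSet_iff.2 (natCast_lt_omega0 n)) (omega_mem_H hκ)
  have hNH : ∀ {N : ZFSet.{u}}, IsCtblElem W κ N → N ∈ H κ := fun h =>
    mem_H_of_countable hreg hκ' h.1 fun _ => h.mem_H
  obtain ⟨N₀, hN₀, hXN₀⟩ := exists_isCtblElem W hκ hX hXH
  -- A stage of the recursion: the current model together with the code of the sequence built so
  -- far. The next model must contain both.
  let T : Type (u + 1) := {p : ZFSet.{u} × ZFSet.{u} // IsCtblElem W κ p.1 ∧
    Set.Countable {z | z ∈ p.2} ∧ p.2 ∈ H κ}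
  have hstep : ∀ p : T, ∃ K, IsCtblElem W κ K ∧ p.1.1 ⊆ K ∧ p.1.1 ∈ K ∧ p.1.2 ∈ K := by
    rintro ⟨⟨N, s⟩, hN, -, hs⟩
    obtain ⟨K, hK, h⟩ := exists_isCtblElem W hκ (X := insert N (insert s {z | z ∈ N}))
      ((hN.1.insert s).insert N) (by
        rintro x (rfl | rfl | hx)
        exacts [hNH hN, hs, hN.mem_H hx])
    exact ⟨K, hK, fun x hx => h x (Or.inr (Or.inr hx)), h _ (Or.inl rfl), h _ (Or.inr (Or.inl rfl))⟩
  choose F hF1 hF2 hF3 hF4 using hstep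
  let A : ℕ → T := fun n => Nat.rec
    ⟨(N₀, {ZFSet.pair ((0 : ℕ) : Ordinal.{u}).toZFSet N₀}), hN₀,
      (Set.countable_singleton (ZFSet.pair ((0 : ℕ) : Ordinal.{u}).toZFSet N₀)).mono
        fun z hz => ZFSet.mem_singleton.1 hz, by
      refine mem_H_of_countable hreg hκ' ?_ fun z hz => ?_
      · exact (Set.countable_singleton (ZFSet.pair ((0 : ℕ) : Ordinal.{u}).toZFSet N₀)).mono
          fun z hz => ZFSet.mem_singleton.1 hz
      · rw [ZFSet.mem_singleton.1 hz]
        exact pair_mem_H hreg hκ' (hnat 0) (hNH hN₀)⟩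
    (fun n p => ⟨(F p, insert (ZFSet.pair ((n + 1 : ℕ) : Ordinal.{u}).toZFSet (F p)) p.1.2), hF1 p,
      (p.2.2.1.insert (ZFSet.pair ((n + 1 : ℕ) : Ordinal.{u}).toZFSet (F p))).mono
        fun z hz => ZFSet.mem_insert_iff.1 hz,
      insert_mem_H hreg hκ' (pair_mem_H hreg hκ' (hnat _) (hNH (hF1 p))) p.2.2.1 p.2.2.2⟩) n
  -- For finite `ξ`, `ξ.card.toNat` recovers the natural number. Every other index receives the
  -- union, although only the index `ω` matters.
  let N : Ordinal.{u} → ZFSet.{u} := fun ξ =>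
    if ξ < omega0 then (A ξ.card.toNat).1.1 else ZFSet.iUnion fun n => (A n).1.1
  have hNn : ∀ n : ℕ, N n = (A n).1.1 := fun n => by
    simp only [N]
    rw [if_pos (natCast_lt_omega0 n), Ordinal.card_nat, Cardinal.toNat_natCast]
  have hNω : N omega0 = ZFSet.iUnion fun n => (A n).1.1 := if_neg (lt_irrefl _)
  have hseq : ∀ n : ℕ, seqUpTo N n = (A n).1.2 := by
    intro n
    induction n with
    | zero =>
      ext z
      rw [mem_seqUpTo]
      change _ ↔ z ∈ ({ZFSet.pair ((0 : ℕ) : Ordinal.{u}).toZFSet N₀} : ZFSet.{u})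
      rw [ZFSet.mem_singleton]
      constructor
      · rintro ⟨ζ, hζ, rfl⟩
        obtain rfl : ζ = ((0 : ℕ) : Ordinal.{u}) := le_antisymm hζ (by simp)
        rw [hNn]
        rfl
      · rintro rfl
        exact ⟨_, le_rfl, by rw [hNn]; rfl⟩
    | succ n ih =>
      ext z
      rw [mem_seqUpTo]
      change _ ↔ z ∈ insert (ZFSet.pair ((n + 1 : ℕ) : Ordinal.{u}).toZFSet (A (n + 1)).1.1)
        (A n).1.2
      rw [ZFSet.mem_insert_iff, ← ih, mem_seqUpTo]
      constructor
      · rintro ⟨ζ, hζ, rfl⟩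
        rcases hζ.eq_or_lt with rfl | hζ
        · exact Or.inl (by rw [hNn])
        · rw [Nat.cast_add, Nat.cast_one] at hζ
          exact Or.inr ⟨ζ, Order.lt_add_one_iff.1 hζ, rfl⟩
      · rintro (rfl | ⟨ζ, hζ, rfl⟩)
        · exact ⟨_, le_rfl, by rw [hNn]⟩
        · exact ⟨ζ, hζ.trans (by exact_mod_cast Nat.le_succ n), rfl⟩
  have hzero : N 0 = N₀ := by
    have := hNn 0
    rwa [Nat.cast_zero] at this
  refine ⟨N, ⟨fun ξ hξ => ?_, ?_, fun ζ hζ => ?_, fun δ hδ hlim x => ?_, fun ξ hξ => ?_⟩,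
    fun x hx => ?_⟩
  · rcases hξ.lt_or_eq with hξ | rfl
    · obtain ⟨n, rfl⟩ := lt_omega0.1 hξ
      rw [hNn]
      exact (A n).2.1
    · rw [hNω]
      exact IsCtblElem.iUnion (fun n => (A n).2.1) fun n => hF2 (A n)
  · rw [hzero]
    exact hN₀.omega_mem hκ
  · obtain ⟨n, rfl⟩ := lt_omega0.1 hζ
    have : N n ∈ N ((n + 1 : ℕ) : Ordinal.{u}) := by
      rw [hNn, hNn]
      exact hF3 (A n)
    exact_mod_cast this
  · obtain rfl : δ = omega0 := le_antisymm hδ (omega0_le_of_isSuccLimit hlim)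
    rw [hNω, ZFSet.mem_iUnion]
    constructor
    · rintro ⟨n, hn⟩
      exact ⟨n, natCast_lt_omega0 n, by rwa [hNn]⟩
    · rintro ⟨ξ, hξ, hx⟩
      obtain ⟨n, rfl⟩ := lt_omega0.1 hξ
      exact ⟨n, by rwa [← hNn]⟩
  · obtain ⟨n, rfl⟩ := lt_omega0.1 hξ
    have : seqUpTo N n ∈ N ((n + 1 : ℕ) : Ordinal.{u}) := by
      rw [hseq, hNn]
      exact hF4 (A n)
    exact_mod_cast this
  · rw [hzero]
    exact hXN₀ x hx

end Existence

/-! ### Forcing notions -/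

namespace ForcingNotion

variable (P : ForcingNotion.{u})

theorem mem_carrier_of_le {q p : ZFSet.{u}} (h : P.le q p) : q ∈ P.carrier ∧ p ∈ P.carrier := by
  obtain ⟨a, ha, b, hb, e⟩ := P.rel_sub _ h
  obtain ⟨rfl, rfl⟩ := ZFSet.pair_inj.1 e
  exact ⟨ha, hb⟩

theorem mem_check {x z : ZFSet.{u}} :
    z ∈ P.check x ↔ ∃ y ∈ x, ZFSet.pair (P.check y) P.one = z := by
  rw [check, ZFSet.mem_range]
  simp

/-- Canonical names that are forced to be equal are names of the same set. -/
theorem eq_of_forcesEq_check {x y p : ZFSet.{u}} (hp : p ∈ P.carrier)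
    (h : P.ForcesEq (P.check x) (P.check y) p) : x = y := by
  induction x using ZFSet.inductionOn generalizing y p with
  | _ x ih =>
    rw [ForcesEq] at h
    ext z
    constructor
    · intro hz
      obtain ⟨r, hr, d, t, hd, -, he⟩ := h.1 _ _ (P.mem_check.2 ⟨z, hz, rfl⟩) p (P.refl p hp)
        (P.le_one p hp)
      obtain ⟨w, hw, e⟩ := P.mem_check.1 hd
      obtain ⟨rfl, -⟩ := ZFSet.pair_inj.1 e
      rwa [ih z hz (P.mem_carrier_of_le hr).1 he]
    · intro hz
      obtain ⟨r, hr, c, s, hc, -, he⟩ := h.2 _ _ (P.mem_check.2 ⟨z, hz, rfl⟩) p (P.refl p hp)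
        (P.le_one p hp)
      obtain ⟨w, hw, e⟩ := P.mem_check.1 hc
      obtain ⟨rfl, -⟩ := ZFSet.pair_inj.1 e
      rwa [← ih w hw (P.mem_carrier_of_le hr).1 he]

end ForcingNotion

/-! ### Conditions of the club forcing and their extensions -/

variable {W : Cardinal.{u} → ZFSet.{u} → ZFSet.{u} → Prop}

theorem IsCtblElem.mem_H_aleph_one {M : ZFSet.{u}} (h : IsCtblElem W (aleph 1) M) :
    M ∈ H (aleph 1) :=
  mem_H_aleph_one_of_countable h.1 fun _ => h.mem_H

theorem mem_carrier_iff {x : ZFSet.{u}} :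
    x ∈ (clubForcing W).carrier ↔ ∃ p : Condition W, p.code = x :=
  ZFSet.mem_range

/-- Extension depends only on the graphs of the two conditions, and these are determined by the
codes. Injectivity of `code` is not needed. -/
theorem le_code_iff {q p : Condition W} : (clubForcing W).le q.code p.code ↔ q.Ext p := by
  constructor
  · intro h
    obtain ⟨⟨⟨q', p'⟩, h'⟩, e⟩ := ZFSet.mem_range.1 h
    obtain ⟨e1, e2⟩ := ZFSet.pair_inj.1 e
    rw [Condition.ext_iff_graph] at h' ⊢
    rwa [← Condition.graph_eq_of_code_eq e1, ← Condition.graph_eq_of_code_eq e2]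
  · exact fun h => ZFSet.mem_range.2 ⟨⟨(q, p), h⟩, rfl⟩

namespace Condition

/-- Models are countable, so a model that belongs to another is included in it. -/
theorem M_mono (p : Condition W) {i j : Fin p.n} (h : i ≤ j) : p.M i ⊆ p.M j := by
  rcases h.eq_or_lt with rfl | h
  · exact fun _ hx => hx
  · exact (p.elem j).subset_of_mem isRegular_aleph_one le_rfl (p.increasing i j h) (p.elem i).1

/-- A promise is required only to lie in the next model, but inclusion of models carries it to all
later ones. It thus also binds models that extensions insert. -/
theorem f_subset (p : Condition W) {i j : Fin p.n} (h : i < j) : p.f i ⊆ p.M j := by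
  let k : Fin p.n := ⟨i.1 + 1, lt_of_le_of_lt h j.2⟩
  exact fun x hx => p.M_mono (i := k) (j := j) h (p.subset_next i k rfl hx)

/-- Adding `ξ` to `f i`, provided that `ξ` is in all later models. -/
noncomputable def addPromise (p : Condition W) (i : Fin p.n) (ξ : ZFSet.{u})
    (hξ : ξ ∈ H (aleph 1)) (hi : ∀ j : Fin p.n, i < j → ξ ∈ p.M j) : Condition W where
  n := p.n
  M := p.M
  f := fun j => if j = i then insert ξ (p.f j) else p.f j
  elem := p.elem
  increasing := p.increasing
  finite := fun j => by
    split_ifs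
    · refine ((p.finite j).insert ξ).subset fun x hx => ?_
      exact ZFSet.mem_insert_iff.1 hx
    · exact p.finite j
  subset_H := fun j x hx => by
    split_ifs at hx
    · rcases ZFSet.mem_insert_iff.1 hx with rfl | hx
      exacts [hξ, p.subset_H j x hx]
    · exact p.subset_H j x hx
  subset_next := fun j k hjk x hx => by
    split_ifs at hx with h
    · rcases ZFSet.mem_insert_iff.1 hx with rfl | hx
      · subst h
        exact hi k (Fin.lt_def.2 (by omega))
      · exact p.subset_next j k hjk hx
    · exact p.subset_next j k hjk hx

theorem addPromise_ext (p : Condition W) (i : Fin p.n) (ξ : ZFSet.{u})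
    (hξ : ξ ∈ H (aleph 1)) (hi : ∀ j : Fin p.n, i < j → ξ ∈ p.M j) :
    (p.addPromise i ξ hξ hi).Ext p := fun j => ⟨j, rfl, fun x hx => by
  simp only [addPromise]
  split_ifs
  exacts [ZFSet.mem_insert_of_mem _ hx, hx]⟩

/-- Every condition can be extended by a model on top that contains a given set. -/
theorem exists_ext_mem (p : Condition W) {x : ZFSet.{u}} (hx : x ∈ H (aleph 1)) :
    ∃ q : Condition W, q.Ext p ∧ ∃ i, x ∈ q.M i := by
  obtain ⟨K, hK, hXK⟩ := exists_isCtblElem W le_rfl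
    (X := insert x (Set.range p.M ∪ ⋃ i, {y | y ∈ p.f i}))
    (((Set.countable_range _).union
      (Set.countable_iUnion fun i => (p.finite i).countable)).insert x)
    (by
      rintro y (rfl | ⟨i, rfl⟩ | hy)
      · exact hx
      · exact (p.elem i).mem_H_aleph_one
      · obtain ⟨i, hi⟩ := Set.mem_iUnion.1 hy
        exact p.subset_H i y hi)
  let q : Condition W :=
    { n := p.n + 1
      M := Fin.snoc (α := fun _ => ZFSet.{u}) p.M K
      f := Fin.snoc (α := fun _ => ZFSet.{u}) p.f ∅
      elem := fun i => by
        refine Fin.lastCases ?_ (fun i => ?_) i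
        · simpa using hK
        · simpa using p.elem i
      increasing := fun i j => by
        refine Fin.lastCases ?_ (fun j => ?_) j
        · refine Fin.lastCases ?_ (fun i => ?_) i
          · exact fun h => (lt_irrefl _ h).elim
          · intro _
            simpa using hXK _ (Or.inr (Or.inl ⟨i, rfl⟩))
        · refine Fin.lastCases ?_ (fun i => ?_) i
          · exact fun h => (h.not_ge (Fin.le_last _)).elim
          · intro h
            simpa using p.increasing i j (by simpa using h)
      finite := fun i => by
        refine Fin.lastCases ?_ (fun i => ?_) i
        · simp
        · simpa using p.finite i
      subset_H := fun i => by
        refine Fin.lastCases ?_ (fun i => ?_) i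
        · simp
        · simpa using p.subset_H i
      subset_next := fun i j => by
        refine Fin.lastCases ?_ (fun i => ?_) i
        · intro _
          simp
        · refine Fin.lastCases ?_ (fun j => ?_) j
          · intro _ y hy
            simp only [Fin.snoc_castSucc, Fin.snoc_last] at hy ⊢
            exact hXK _ (Or.inr (Or.inr (Set.mem_iUnion.2 ⟨i, hy⟩)))
          · intro h
            simpa using p.subset_next i j (by simpa using h) }
  refine ⟨q, fun i => ⟨i.castSucc, ?_, ?_⟩, Fin.last _, ?_⟩
  · simp [q]
  · simp [q]
  · simpa [q] using hXK x (Or.inl rfl)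

/-- Given an increasing sequence of models `N n`, every condition has an extension `r` such that,
for some `m` and some `η ∈ N m`, the models in extensions of `r` which contain `η` also contain a
countable ordinal that is not in `N m`. -/
theorem exists_ext_avoiding {κ : Cardinal.{u}} (hκ : aleph 1 ≤ κ) {N : ℕ → ZFSet.{u}}
    (hN : ∀ n, IsCtblElem W κ (N n)) (hmem : ∀ n, N n ∈ N (n + 1)) (q : Condition W) :
    ∃ m, ∃ r : Condition W, r.Ext q ∧ ∃ η ∈ delta (N m), ∀ s : Condition W, s.Ext r → ∀ k,
      η ∈ s.M k → ∃ ξ ∈ delta (s.M k), ξ ∉ N m := by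
  have hnew : ∀ m, ∃ ξ ∈ N (m + 1), ξ ∉ N m ∧ ξ ∈ (Ordinal.omega.{u} 1).toZFSet := fun m =>
    (hN (m + 1)).exists_mem_omega_one_not_mem hκ (hmem m) (hN m).1
  let Δ : Set ZFSet.{u} := {x | x ∈ (Ordinal.omega.{u} 1).toZFSet ∧ ∃ n, x ∈ N n}
  by_cases hA : ∃ r : Condition W, r.Ext q ∧ ∃ i, ¬ ∀ x ∈ Δ, x ∈ r.M i
  · obtain ⟨r, hr, hi⟩ := hA
    -- Minimality with respect to `>` selects the topmost model that does not include `Δ`.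
    obtain ⟨i, hi, hmax⟩ := WellFounded.has_min (wellFounded_gt (α := Fin r.n))
      {i | ¬ ∀ x ∈ Δ, x ∈ r.M i} hi
    obtain ⟨η, hη⟩ := not_forall.1 hi
    obtain ⟨⟨hη1, m, hηm⟩, hη2⟩ := Classical.not_imp.1 hη
    obtain ⟨ξ, hξ1, hξ2, hξ3⟩ := hnew m
    have hξH : ξ ∈ H (aleph 1) := by
      obtain ⟨a, ha, rfl⟩ := Ordinal.mem_toZFSet_iff.1 hξ3
      exact toZFSet_mem_H_of_countable ha
    -- The promise is legal: the later models include `Δ`, and `ξ ∈ Δ` because `ξ ∈ N (m + 1)`.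
    have hnext : ∀ j : Fin r.n, i < j → ξ ∈ r.M j := fun j hj => by
      by_contra hcon
      exact hmax j (fun h => hcon (h ξ ⟨hξ3, _, hξ1⟩)) hj
    refine ⟨m, r.addPromise i ξ hξH hnext, (r.addPromise_ext i ξ hξH hnext).trans hr, η,
      ZFSet.mem_inter.2 ⟨hηm, hη1⟩, fun s hs k hk => ⟨ξ, ZFSet.mem_inter.2 ⟨?_, hξ3⟩, hξ2⟩⟩
    obtain ⟨j, hj, hf⟩ := hs i
    have hξf : ξ ∈ s.f j := hf (by simp [addPromise])
    -- Up to position `j`, the models of `s` are included in `r.M i`, which omits `η`. Beyond it,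
    -- the promise puts `ξ` in them.
    rcases le_or_gt k j with h | h
    · refine (hη2 ?_).elim
      have := s.M_mono h hk
      rw [hj] at this
      exact this
    · exact s.f_subset h hξf
  · push Not at hA
    obtain ⟨ξ, hξ1, hξ2, hξ3⟩ := hnew 0
    -- All models of all extensions include `Δ`, so `η` plays no role; `∅` is merely some element of
    -- `delta (N 0)`.
    refine ⟨0, q, Ext.refl q, ∅, ZFSet.mem_inter.2 ⟨?_, ?_⟩, fun s hs k _ =>
      ⟨ξ, ZFSet.mem_inter.2 ⟨hA s hs k ξ ⟨hξ3, _, hξ1⟩, hξ3⟩, hξ2⟩⟩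
    · exact (hN 0).omega_subset hκ _ inductive_omega.1
    · rw [← Ordinal.toZFSet_zero, Ordinal.toZFSet_mem_toZFSet_iff]
      exact omega_pos 1

end Condition

/-! ### Conditions with a model that contains a given set -/

/-- `x` codes a condition one of whose models contains `y`. -/
def HasModel (x y : ZFSet.{u}) : Prop :=
  ∃ s g i K, x = ZFSet.pair s g ∧ ZFSet.pair i K ∈ s ∧ y ∈ K

/-- Lets a first-order formula read the models of a condition off its code, forgetting their
positions. -/
theorem pair_mem_seq_iff {p : Condition W} {s g K : ZFSet.{u}} (h : p.code = ZFSet.pair s g) :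
    (∃ i, ZFSet.pair i K ∈ s) ↔ ∃ i, p.M i = K := by
  obtain ⟨rfl, rfl⟩ := ZFSet.pair_inj.1 h
  constructor
  · rintro ⟨i, hi⟩
    obtain ⟨j, hj⟩ := ZFSet.mem_range.1 hi
    exact ⟨j, (ZFSet.pair_inj.1 hj).2⟩
  · rintro ⟨i, rfl⟩
    exact ⟨_, ZFSet.mem_range.2 ⟨i, rfl⟩⟩

theorem hasModel_code_iff {p : Condition W} {y : ZFSet.{u}} :
    HasModel p.code y ↔ ∃ i, y ∈ p.M i := by
  constructor
  · rintro ⟨s, g, i, K, h, hK, hy⟩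
    obtain ⟨j, rfl⟩ := (pair_mem_seq_iff h).1 ⟨i, hK⟩
    exact ⟨j, hy⟩
  · rintro ⟨j, hj⟩
    obtain ⟨i, hi⟩ := (pair_mem_seq_iff (p := p) rfl).2 ⟨j, rfl⟩
    exact ⟨_, _, i, _, rfl, hi, hj⟩

section

variable {κ : Cardinal.{u}} {α : Type*}

/-- `HasModel`, with a specified model. -/
theorem FODef.isModelOf (i j k : α) : FODef setLang fun v : α → HModel W κ =>
    ∃ s g l : HModel W κ, (v i).1 = ZFSet.pair s.1 g.1 ∧ ZFSet.pair l.1 (v j).1 ∈ s.1 ∧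
      (v k).1 ∈ (v j).1 :=
  ex (ex (ex ((eq_pair (some (some (some i))) (some (some none)) (some none)).and
    ((pair_mem none (some (some (some j))) (some (some none))).and
      (mem (some (some (some k))) (some (some (some j))))))))

theorem FODef.hasModel (i j : α) :
    FODef setLang fun v : α → HModel W κ => HasModel (v i).1 (v j).1 := by
  refine congr (ex (R := fun v K => ∃ s g l : HModel W κ, (v i).1 = ZFSet.pair s.1 g.1 ∧
    ZFSet.pair l.1 K.1 ∈ s.1 ∧ (v j).1 ∈ K.1) (isModelOf (some i) none (some j))) fun v => ?_
  constructor
  · rintro ⟨K, s, g, l, h1, h2, h3⟩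
    exact ⟨s.1, g.1, l.1, K.1, h1, h2, h3⟩
  · rintro ⟨s, g, l, K, h1, h2, h3⟩
    have hi := (v i).2
    rw [h1] at hi
    have hl := mem_H_of_mem h2 (fst_mem_H hi)
    exact ⟨⟨K, snd_mem_H hl⟩, ⟨s, fst_mem_H hi⟩, ⟨g, snd_mem_H hi⟩, ⟨l, fst_mem_H hl⟩, h1, h2, h3⟩

/-- If `q` is `(N, ℙ)`-generic and `η ∈ N` is a countable ordinal, then every extension of `q` is
compatible with a condition that has a model containing `η` and included in `N`. -/
theorem exists_model_subset_of_generic (hreg : κ.IsRegular) (hκ : aleph 1 ≤ κ) {N : ZFSet.{u}}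
    (hN : IsCtblElem W κ N) (hP : (clubForcing W).code ∈ N) {q : ZFSet.{u}}
    (hq : (clubForcing W).Generic N q)
    {η : ZFSet.{u}} (hη : η ∈ N) (hηH : η ∈ H (aleph 1)) {r : Condition W}
    (hr : (clubForcing W).le r.code q) :
    ∃ s : Condition W, s.Ext r ∧ ∃ k, η ∈ s.M k ∧ s.M k ⊆ N := by
  have hcH : (clubForcing W).carrier ∈ H κ := fst_mem_H (hN.mem_H hP)
  let D₀ : ZFSet.{u} := (clubForcing W).carrier.sep fun x => HasModel x η
  -- `D₀` is definable from `η` and the code of the forcing, so it has a counterpart in `N`.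
  obtain ⟨D, hDN, c, t, hc, hD⟩ := hN.exists_mem (α := Bool)
    (R := fun v D => ∃ c t : HModel W κ, (v false).1 = ZFSet.pair c.1 t.1 ∧ ∀ x : HModel W κ,
      x.1 ∈ D.1 ↔ x.1 ∈ c.1 ∧ HasModel x.1 (v true).1)
    (FODef.ex (FODef.ex ((FODef.eq_pair (some (some (some false))) (some none) none).and
      (FODef.all ((FODef.mem none (some (some (some none)))).iff
        ((FODef.mem none (some (some none))).and
          (FODef.hasModel none (some (some (some (some true)))))))))))
    (fun b => bif b then ⟨η, hN.mem_H hη⟩ else ⟨_, hN.mem_H hP⟩)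
    (by rintro (_ | _); exacts [hP, hη])
    ⟨⟨D₀, mem_H_of_subset ZFSet.sep_subset hcH⟩, ⟨_, hcH⟩, ⟨_, snd_mem_H (hN.mem_H hP)⟩, rfl,
      fun x => by
      change x.1 ∈ D₀ ↔ x.1 ∈ (clubForcing W).carrier ∧ HasModel x.1 η
      exact ZFSet.mem_sep⟩
  have hc' : (clubForcing W).carrier = c.1 := (ZFSet.pair_inj.1 hc).1
  have hD' : ∀ x, x ∈ D.1 ↔ ∃ p : Condition W, p.code = x ∧ ∃ i, η ∈ p.M i := by
    intro x
    constructor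
    · intro hx
      obtain ⟨h1, h2⟩ := (hD ⟨x, mem_H_of_mem hx D.2⟩).1 hx
      rw [← hc'] at h1
      obtain ⟨p, rfl⟩ := mem_carrier_iff.1 h1
      exact ⟨p, rfl, hasModel_code_iff.1 h2⟩
    · rintro ⟨p, rfl, hp⟩
      have h1 : p.code ∈ (clubForcing W).carrier := mem_carrier_iff.2 ⟨p, rfl⟩
      refine (hD ⟨_, mem_H_of_mem h1 hcH⟩).2 ⟨?_, hasModel_code_iff.2 hp⟩
      rwa [← hc']
  have hdense : (clubForcing W).DenseOpen D.1 := by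
    refine ⟨fun x hx => ?_, fun x hx => ?_, fun x hx y hyx => ?_⟩
    · obtain ⟨p, rfl, -⟩ := (hD' x).1 hx
      exact mem_carrier_iff.2 ⟨p, rfl⟩
    · obtain ⟨p, rfl⟩ := mem_carrier_iff.1 hx
      obtain ⟨p', h1, h2⟩ := p.exists_ext_mem hηH
      exact ⟨p'.code, (hD' _).2 ⟨p', rfl, h2⟩, le_code_iff.2 h1⟩
    · obtain ⟨p, rfl, i, hi⟩ := (hD' x).1 hx
      obtain ⟨p', rfl⟩ := mem_carrier_iff.1 (ForcingNotion.mem_carrier_of_le _ hyx).1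
      obtain ⟨j, hj, -⟩ := le_code_iff.1 hyx i
      exact (hD' _).2 ⟨p', rfl, j, by rwa [hj]⟩
  obtain ⟨t, ht, s, hsr, hst⟩ := hq.2 D.1 hDN hdense r.code hr
  obtain ⟨htD, htN⟩ := ZFSet.mem_inter.1 ht
  obtain ⟨p, rfl, i, hi⟩ := (hD' t).1 htD
  obtain ⟨s, rfl⟩ := mem_carrier_iff.1 (ForcingNotion.mem_carrier_of_le _ hsr).1
  have hpH := hN.mem_H htN
  obtain ⟨l, hl⟩ := (pair_mem_seq_iff (p := p) rfl).2 ⟨i, rfl⟩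
  have hlH := mem_H_of_mem hl (fst_mem_H hpH)
  -- Elementarity yields a model `K ∈ N` of `p` containing `η`, possibly different from `p.M i`.
  -- Being countable, `K` is included in `N`, and it is still a model of the common extension `s`.
  obtain ⟨K, hKN, s', g', l', h1, h2, h3⟩ := hN.exists_mem (α := Bool)
    (R := fun v K => ∃ s g l : HModel W κ, (v false).1 = ZFSet.pair s.1 g.1 ∧
      ZFSet.pair l.1 K.1 ∈ s.1 ∧ (v true).1 ∈ K.1)
    (FODef.isModelOf (some false) none (some true))
    (fun b => bif b then ⟨η, hN.mem_H hη⟩ else ⟨_, hpH⟩)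
    (by rintro (_ | _); exacts [htN, hη])
    ⟨⟨_, snd_mem_H hlH⟩, ⟨_, fst_mem_H hpH⟩, ⟨_, snd_mem_H hpH⟩, ⟨_, fst_mem_H hlH⟩, rfl, hl, hi⟩
  obtain ⟨j, hj⟩ := (pair_mem_seq_iff h1).1 ⟨_, h2⟩
  obtain ⟨k, hk, -⟩ := le_code_iff.1 hst j
  refine ⟨s, le_code_iff.1 hsr, k, ?_, ?_⟩
  · rw [hk, hj]
    exact h3
  · rw [hk, hj]
    refine hN.subset_of_mem hreg hκ hKN ?_
    rw [← hj]
    exact (p.elem j).1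

end

/-! ### Towers -/

section Towers

variable {κ : Cardinal.{u}} {N : Ordinal.{u} → ZFSet.{u}}

theorem aleph_one_le_of_omega_mem_H (h : (omega0.{u}).toZFSet ∈ H κ) : aleph 1 ≤ κ := by
  rw [← succ_aleph0, Order.succ_le_iff]
  refine lt_of_le_of_lt ?_ (show _ < κ from h)
  have := ZFSet.card_mono (subset_trCl (omega0.{u}).toZFSet)
  rwa [Ordinal.card_toZFSet, card_omega0] at this

/-- The clause placing the index `ω` in `N 0` already forces `κ` to be uncountable, so no largeness
of `κ` has to be assumed for towers. -/
theorem IsTower.aleph_one_le (h : IsTower W κ omega0 N) : aleph 1 ≤ κ :=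
  aleph_one_le_of_omega_mem_H ((h.elem 0 zero_le).mem_H h.index_mem)

theorem IsTower.exists_ext_avoiding (h : IsTower W κ omega0 N) (q : Condition W) :
    ∃ m : ℕ, ∃ r : Condition W, r.Ext q ∧ ∃ η ∈ delta (N m), ∀ s : Condition W, s.Ext r → ∀ k,
      η ∈ s.M k → ∃ ξ ∈ delta (s.M k), ξ ∉ N m :=
  Condition.exists_ext_avoiding h.aleph_one_le (N := fun n : ℕ => N n)
    (fun n => h.elem n (natCast_lt_omega0 n).le)
    (fun n => by simpa using h.mem_succ n (natCast_lt_omega0 n)) q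

theorem IsTower.mem_of_mem_zero (h : IsTower W κ omega0 N) (hreg : κ.IsRegular) {x : ZFSet.{u}}
    (hx : x ∈ N 0) (m : ℕ) : x ∈ N m := by
  induction m with
  | zero => simpa using hx
  | succ m ih =>
    have hm := h.mem_succ m (natCast_lt_omega0 m)
    have hel := h.elem (m + 1) (by exact_mod_cast (natCast_lt_omega0 (m + 1)).le)
    have := hel.subset_of_mem hreg h.aleph_one_le hm (h.elem m (natCast_lt_omega0 m).le).1 ih
    exact_mod_cast this

theorem IsTower.exists_forcesNotMem (h : IsTower W κ omega0 N) {q : ZFSet.{u}}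
    (hq : q ∈ (clubForcing W).carrier) :
    ∃ m < omega0, ∃ r, (clubForcing W).le r q ∧
      (clubForcing W).ForcesNotMem ((clubForcing W).check (delta (N m))) (clubName W) r := by
  obtain ⟨q, rfl⟩ := mem_carrier_iff.1 hq
  obtain ⟨m, r, hr, η, hη, hs⟩ := h.exists_ext_avoiding q
  refine ⟨m, natCast_lt_omega0 m, r.code, le_code_iff.2 hr, fun s hsr hmem => ?_⟩
  obtain ⟨t, hts, c, p, hcp, htp, he⟩ :=
    hmem s ((clubForcing W).refl s (ForcingNotion.mem_carrier_of_le _ hsr).1)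
  obtain ⟨⟨p, i⟩, e⟩ := ZFSet.mem_range.1 hcp
  obtain ⟨rfl, rfl⟩ := ZFSet.pair_inj.1 e
  have htc := (ForcingNotion.mem_carrier_of_le _ hts).1
  -- The forced equality of check names is a true equality `delta (N m) = delta (p.M i)`, and `p.M
  -- i` is also a model of `t`, an extension of `r`.
  have hδ := ForcingNotion.eq_of_forcesEq_check _ htc he
  obtain ⟨t, rfl⟩ := mem_carrier_iff.1 htc
  obtain ⟨k, hk, -⟩ := le_code_iff.1 htp i
  have htr : t.Ext r := le_code_iff.1 ((clubForcing W).trans _ _ _ hts hsr)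
  change delta (N m) = delta (p.M i) at hδ
  rw [← hk] at hδ
  obtain ⟨ξ, hξ, hξN⟩ := hs t htr k (ZFSet.mem_inter.1 (hδ ▸ hη)).1
  rw [← hδ] at hξ
  exact hξN (ZFSet.mem_inter.1 hξ).1

theorem IsTower.not_exists_generic (h : IsTower W κ omega0 N) (hreg : κ.IsRegular)
    (hP : (clubForcing W).code ∈ N 0) :
    ¬ ∃ q ∈ (clubForcing W).carrier, ∀ i ≤ omega0, (clubForcing W).Generic (N i) q := by
  rintro ⟨q, hq, hgen⟩
  obtain ⟨q, rfl⟩ := mem_carrier_iff.1 hq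
  obtain ⟨m, r, hr, η, hη, hs⟩ := h.exists_ext_avoiding q
  obtain ⟨hη1, hη2⟩ := ZFSet.mem_inter.1 hη
  obtain ⟨a, ha, rfl⟩ := Ordinal.mem_toZFSet_iff.1 hη2
  obtain ⟨s, hsr, k, hk, hsub⟩ := exists_model_subset_of_generic hreg h.aleph_one_le
    (h.elem m (natCast_lt_omega0 m).le) (h.mem_of_mem_zero hreg hP m)
    (hgen m (natCast_lt_omega0 m).le) hη1 (toZFSet_mem_H_of_countable ha) (le_code_iff.2 hr)
  obtain ⟨ξ, hξ, hξN⟩ := hs s hsr k hk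
  exact hξN (hsub (ZFSet.mem_inter.1 hξ).1)

end Towers

/-! ### Failure of `ω`-properness -/

theorem aleph0_le_card_trCl_code (W : Cardinal.{u} → ZFSet.{u} → ZFSet.{u} → Prop) :
    ℵ₀ ≤ (trCl (clubForcing W).code).card := by
  -- Any condition with at least one model would do: the model includes `ω` and lies in the
  -- transitive closure.
  obtain ⟨p, -, i, -⟩ := (Condition.empty W).exists_ext_mem (omega_mem_H le_rfl)
  have htr : ∀ {x y : ZFSet.{u}}, x ∈ y → y ∈ trCl (clubForcing W).code →
      x ∈ trCl (clubForcing W).code := fun hx hy => isTransitive_trCl _ _ hy hx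
  have hfst : ∀ {x y : ZFSet.{u}}, ZFSet.pair x y ∈ trCl (clubForcing W).code →
      x ∈ trCl (clubForcing W).code := fun {x y} h =>
    htr (y := {x}) (by simp) (htr (by simp [ZFSet.pair]) h)
  have hsnd : ∀ {x y : ZFSet.{u}}, ZFSet.pair x y ∈ trCl (clubForcing W).code →
      y ∈ trCl (clubForcing W).code := fun {x y} h =>
    htr (y := {x, y}) (by simp) (htr (by simp [ZFSet.pair]) h)
  have hcar : (clubForcing W).carrier ∈ trCl (clubForcing W).code :=
    htr (y := {(clubForcing W).carrier}) (by simp)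
      (subset_trCl _ (by simp [ForcingNotion.code, ZFSet.pair]))
  have hp : p.code ∈ trCl (clubForcing W).code := htr (mem_carrier_iff.2 ⟨p, rfl⟩) hcar
  have hM : p.M i ∈ trCl (clubForcing W).code :=
    hsnd (htr (ZFSet.mem_range.2 ⟨i, rfl⟩) (hfst hp))
  have hω : (omega0.{u}).toZFSet ⊆ trCl (clubForcing W).code := fun x hx =>
    htr ((p.elem i).omega_subset le_rfl x hx) hM
  have := ZFSet.card_mono hω
  rwa [Ordinal.card_toZFSet, card_omega0] at this

theorem not_alphaProperAt_omega0 (W : Cardinal.{u} → ZFSet.{u} → ZFSet.{u} → Prop)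
    {κ : Cardinal.{u}} (h : (clubForcing W).LargeEnough κ) :
    ¬ (clubForcing W).AlphaProperAt W κ omega0 := by
  obtain ⟨hreg, hlt⟩ := h
  have hcard : (trCl (clubForcing W).code).card < κ :=
    ((Cardinal.cantor _).trans (Order.lt_succ _)).trans hlt
  have hκ : aleph 1 ≤ κ := by
    rw [← succ_aleph0, Order.succ_le_iff]
    exact (aleph0_le_card_trCl_code W).trans_lt hcard
  have hone : (clubForcing W).one ∈ H κ := snd_mem_H (snd_mem_H (κ := κ) hcard)
  obtain ⟨N, hN, hX⟩ := exists_isTower W hreg hκ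
    (X := {(clubForcing W).code, (clubForcing W).one}) (Set.to_countable _) (by
      rintro x (rfl | rfl)
      exacts [hcard, hone])
  intro hprop
  obtain ⟨q, hq, hgen⟩ := hprop N hN (hX _ (Or.inl rfl)) _ (clubForcing W).one_mem
    (hX _ (Or.inr rfl))
  exact hN.not_exists_generic hreg (hX _ (Or.inl rfl))
    ⟨q, (ForcingNotion.mem_carrier_of_le _ hq).1, hgen⟩

theorem not_alphaProper_omega0 (W : Cardinal.{u} → ZFSet.{u} → ZFSet.{u} → Prop) :
    ¬ (clubForcing W).AlphaProper W omega0 := by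
  intro h
  -- The successor of `μ` is a regular cardinal that is large enough.
  let μ : Cardinal.{u} := Order.succ (2 ^ (trCl (clubForcing W).code).card)
  have hμ : ℵ₀ ≤ μ := (aleph0_le_card_trCl_code W).trans
    ((Cardinal.cantor _).trans (Order.lt_succ _)).le
  have hreg : (Order.succ μ).IsRegular := isRegular_succ hμ
  exact not_alphaProperAt_omega0 W ⟨hreg, Order.lt_succ μ⟩ (h _ hreg)

end ClubForcing

theorem mainTheorem3
    (W : Cardinal.{u} → ZFSet.{u} → ZFSet.{u} → Prop)
    (hW : ∀ κ : Cardinal.{u}, κ.IsRegular →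
      IsWellOrder (ClubForcing.H κ) (fun x y => W κ x.1 y.1)) :
    ¬ (ClubForcing.clubForcing W).AlphaProper W Ordinal.omega0 ∧
    (∀ κ : Cardinal.{u}, (ClubForcing.clubForcing W).LargeEnough κ →
      ¬ (ClubForcing.clubForcing W).AlphaProperAt W κ Ordinal.omega0) ∧
    ∀ κ : Cardinal.{u}, κ.IsRegular → ∀ N : Ordinal.{u} → ZFSet.{u},
      ClubForcing.IsTower W κ Ordinal.omega0 N →
      (ClubForcing.clubForcing W).code ∈ N 0 → ClubForcing.clubName W ∈ N 0 →
      (¬ ∃ q ∈ (ClubForcing.clubForcing W).carrier,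
        ∀ i ≤ Ordinal.omega0, (ClubForcing.clubForcing W).Generic (N i) q) ∧
      ∀ q ∈ (ClubForcing.clubForcing W).carrier, ∃ m < Ordinal.omega0,
        ∃ r, (ClubForcing.clubForcing W).le r q ∧
          (ClubForcing.clubForcing W).ForcesNotMem
            ((ClubForcing.clubForcing W).check (ClubForcing.delta (N m)))
            (ClubForcing.clubName W) r := by
  refine ⟨ClubForcing.not_alphaProper_omega0 W,
    fun κ hκ => ClubForcing.not_alphaProperAt_omega0 W hκ, fun κ hκ N hN hP _ => ⟨?_, ?_⟩⟩
  · exact hN.not_exists_generic hκ hP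
  · exact fun q hq => hN.exists_forcesNotMem hq
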